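/- Let $M$ be a connected open (noncompact) smooth surface and let $g_0$ be a Riemannian metric of class $C^2$ on $M$ which is asymptotically conical of some order $\tau>0$: the complement of some compact subset of $M$ is a disjoint union of finitely many ends $E_j$, each properly identified with $\{r>R_j\}\times S^1$ with coordinates $(r,\theta)$, $R_j>0$, on which $$g_0 = dr^2+\alpha_j^2r^2d\theta^2+k_j,\qquad \alpha_j>0,\quad k_j\in r^{-\tau}\Lambda^{2,a}$$ for a fixed $a\in(0,1)$; here $k\in r^{-\tau}\Lambda^{2,a}$ means that the components of $r^{\tau}k$ in the orthonormal frame $\partial_r,(\alpha_jr)^{-1}\partial_\theta$ of the cone are $C^2$, with derivatives of order at most two along this frame bounded and those of order two uniformly $a$-Hölder continuous for the conical metric. Denote by $R_0$ the scalar curvature of $g_0$ and by $\Delta_{g_0}$ its Laplace–Beltrami operator. Let $u_0$ be a function on $M$ with $c\le u_0\le c'$ for some constants $0<c\le c'$, and let $u>0$ be a solution on $M\times[0,\infty)$ of $$\partial_t u=\Delta_{g_0}\log u-R_0,\qquad u(\cdot,0)=u_0,$$ that is, $u$ is continuous on $M\times[0,\infty)$, $u(\cdot,t)$ is of class $C^2$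 for each $t>0$, and at every point with $t>0$ the derivative $\partial_t u$ exists and the equation holds. Assume that $u$ belongs to the class of solutions of bounded curvature: for every $T<\infty$ the scalar curvature of the metrics $g(t)=u(\cdot,t)g_0$ is bounded on $M\times(0,T]$. Then $$\partial_t u(x,t)\le\frac{u(x,t)}{t}\qquad\text{for all }x\in M,\ t>0,$$ and there is a constant $C>0$ such that $$u(x,t)\le C(1+t)\qquad\text{for all }x\in M,\ t\ge 0.$$ -/

import Mathlib

open Set
open scoped Manifold ContDiff

noncomputable section

namespace ConicalRicci

/-- The Euclidean plane, the model space of surfaces. -/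
abbrev Plane : Type := EuclideanSpace ℝ (Fin 2)

/-! ### Coordinate calculus on the plane -/

/-- The partial derivative `∂ᵢ f` at `y`. -/
def pd (i : Fin 2) (f : Plane → ℝ) (y : Plane) : ℝ :=
  fderiv ℝ f y (EuclideanSpace.single i 1)

/-- The Christoffel symbol `Γᵏᵢⱼ = ½ gᵏˡ (∂ᵢ gⱼₗ + ∂ⱼ gᵢₗ - ∂ₗ gᵢⱼ)` of a coordinate metric `G`. -/
def christoffel (G : Plane → Matrix (Fin 2) (Fin 2) ℝ) (k i j : Fin 2) (y : Plane) : ℝ :=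
  ∑ l, (1 / 2) * (G y)⁻¹ k l *
    (pd i (fun z => G z j l) y + pd j (fun z => G z i l) y - pd l (fun z => G z i j) y)

/-- The Ricci tensor
`Rᵢⱼ = ∂ₖ Γᵏᵢⱼ - ∂ⱼ Γᵏᵢₖ + Γᵏₖₗ Γˡᵢⱼ - Γᵏⱼₗ Γˡᵢₖ` of a coordinate metric `G`. -/
def coordRicci (G : Plane → Matrix (Fin 2) (Fin 2) ℝ) (i j : Fin 2) (y : Plane) : ℝ :=
  ∑ k, (pd k (christoffel G k i j) y - pd j (christoffel G k i k) y) +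
    ∑ k, ∑ l, (christoffel G k k l y * christoffel G l i j y -
      christoffel G k j l y * christoffel G l i k y)

/-- The scalar curvature `R = gⁱʲ Rᵢⱼ` (twice the Gauss curvature) of a coordinate metric `G`. -/
def coordScalarCurv (G : Plane → Matrix (Fin 2) (Fin 2) ℝ) (y : Plane) : ℝ :=
  ∑ i, ∑ j, (G y)⁻¹ i j * coordRicci G i j y

/-- The Laplacian `Δ f = gⁱʲ (∂ᵢ∂ⱼ f - Γᵏᵢⱼ ∂ₖ f)` of a coordinate metric `G`. -/
def coordLaplacian (G : Plane → Matrix (Fin 2) (Fin 2) ℝ) (f : Plane → ℝ) (y : Plane) : ℝ :=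
  ∑ i, ∑ j, (G y)⁻¹ i j * (pd i (pd j f) y - ∑ k, christoffel G k i j y * pd k f y)

/-! ### Metrics on a surface -/

section Surface

variable {M : Type*} [TopologicalSpace M] [ChartedSpace Plane M]

/-- A field of bilinear forms on the tangent spaces of `M`. -/
abbrev BilinField (M : Type*) [TopologicalSpace M] [ChartedSpace Plane M] : Type _ :=
  ∀ x : M, TangentSpace (𝓡 2) x →L[ℝ] TangentSpace (𝓡 2) x →L[ℝ] ℝ

/-- A Riemannian metric of class `C²` on `M`. -/
abbrev Metric (M : Type*) [TopologicalSpace M] [ChartedSpace Plane M] [IsManifold (𝓡 2) ∞ M] :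
    Type _ :=
  Bundle.ContMDiffRiemannianMetric (𝓡 2) 2 Plane (fun x : M => TangentSpace (𝓡 2) x)

/-- The matrix `(F^* h)ᵢⱼ = h(∂ᵢ F, ∂ⱼ F)` of the pull-back of `h` by a map `F` from the plane
to `M`. -/
def pullback (h : BilinField M) (F : Plane → M) (y : Plane) : Matrix (Fin 2) (Fin 2) ℝ :=
  Matrix.of fun i j => h (F y)
    (mfderiv (𝓡 2) (𝓡 2) F y (EuclideanSpace.single i (1 : ℝ) : Plane))
    (mfderiv (𝓡 2) (𝓡 2) F y (EuclideanSpace.single j (1 : ℝ) : Plane))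

/-- The scalar curvature of `h` at the point `x`, computed in the local coordinates `e`. -/
def scalarCurvIn (e : OpenPartialHomeomorph M Plane) (h : BilinField M) (x : M) : ℝ :=
  coordScalarCurv (pullback h e.symm) (e x)

/-- The Laplacian of `f` with respect to `h` at the point `x`, computed in the local
coordinates `e`. -/
def laplacianIn (e : OpenPartialHomeomorph M Plane) (h : BilinField M) (f : M → ℝ) (x : M) : ℝ :=
  coordLaplacian (pullback h e.symm) (f ∘ e.symm) (e x)

/-- The conformal field `w h`. -/
def conformal (w : M → ℝ) (h : BilinField M) : BilinField M := fun x => w x • h x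

/-! ### Asymptotically conical metrics -/

/-- The part `r > ρ` of the plane with coordinates `(r, θ) = (p 0, p 1)`. -/
def outer (ρ : ℝ) : Set Plane := {p | ρ < p 0}

/-- Polar coordinates `(r, θ)`, `r > R`, on an end of `M`: a diffeomorphism of
`(R, ∞) × (ℝ / 2πℤ)` onto an open subset of `M`, lifted to `(R, ∞) × ℝ`, such that `r → ∞`
leaves every compact subset of `M`. -/
structure PolarEnd (M : Type*) [TopologicalSpace M] [ChartedSpace Plane M] where
  /-- the smallest radius -/
  R : ℝ
  R_pos : 0 < R
  /-- the inverse of the coordinates, `(r, θ) ↦ x` -/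
  toFun : Plane → M
  isLocalDiffeomorphOn : IsLocalDiffeomorphOn (𝓡 2) (𝓡 2) ∞ toFun (outer R)
  eq_iff : ∀ p ∈ outer R, ∀ q ∈ outer R,
    toFun p = toFun q ↔ p 0 = q 0 ∧ ∃ n : ℤ, q 1 = p 1 + 2 * Real.pi * n
  isClosed : ∀ ρ, R < ρ → IsClosed (toFun '' {p | ρ ≤ p 0})

/-- The factors of the frame `∂_r, (α r)⁻¹ ∂_θ`, which is orthonormal for the conical metric
`dr² + α² r² dθ²`. -/
def coneScale (α : ℝ) (i : Fin 2) (p : Plane) : ℝ := if i = 0 then 1 else (α * p 0)⁻¹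

/-- Differentiation along the frame `∂_r, (α r)⁻¹ ∂_θ`. -/
def coneDeriv (α : ℝ) (i : Fin 2) (f : Plane → ℝ) (p : Plane) : ℝ := coneScale α i p * pd i f p

/-- A distance-like function on the cone `dr² + α² r² dθ²`; minimized over the choices of `θ`
modulo `2π` it is comparable to the distance of the cone. -/
def coneDist (α : ℝ) (p q : Plane) : ℝ := |p 0 - q 0| + α * min (p 0) (q 0) * |p 1 - q 1|

/-- The Hölder space `Λ^{2,a}` of the part `r > R` of the cone `dr² + α² r² dθ²`: the derivatives
of order at most two are bounded, and those of order two are `a`-Hölder continuous, all measured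
with the conical metric. -/
def MemHolder (α R a : ℝ) (f : Plane → ℝ) : Prop :=
  ContDiffOn ℝ 2 f (outer R) ∧ ∃ C : ℝ,
    (∀ p ∈ outer R, |f p| ≤ C) ∧
    (∀ p ∈ outer R, ∀ i, |coneDeriv α i f p| ≤ C) ∧
    (∀ p ∈ outer R, ∀ i j, |coneDeriv α i (coneDeriv α j f) p| ≤ C) ∧
    (∀ p ∈ outer R, ∀ q ∈ outer R, ∀ i j,
      |coneDeriv α i (coneDeriv α j f) p - coneDeriv α i (coneDeriv α j f) q| ≤
        C * coneDist α p q ^ a)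

/-- The weighted Hölder space `r^μ Λ^{2,a}`. -/
def MemWeightedHolder (α R μ a : ℝ) (f : Plane → ℝ) : Prop :=
  MemHolder α R a (fun p => p 0 ^ (-μ) * f p)

/-- The components of `k = h - (dr² + α² r² dθ²)` on an end in the orthonormal frame
`∂_r, (α r)⁻¹ ∂_θ`. -/
def coneError (h : BilinField M) (E : PolarEnd M) (α : ℝ) (i j : Fin 2) (p : Plane) : ℝ :=
  coneScale α i p * coneScale α j p * pullback h E.toFun p i j - if i = j then 1 else 0

/-- `h` is asymptotically conical of order `τ`, with Hölder exponent `a`: outside a compact set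
`M` consists of finitely many disjoint ends with polar coordinates, and on each of them
`h = dr² + α² r² dθ² + k` with some `α > 0` and `k ∈ r^{-τ} Λ^{2,a}`. -/
def IsAsymptoticallyConical (h : BilinField M) (τ a : ℝ) : Prop :=
  ∃ (n : ℕ) (E : Fin n → PolarEnd M) (α : Fin n → ℝ),
    (∀ i j, i ≠ j →
      Disjoint ((E i).toFun '' outer (E i).R) ((E j).toFun '' outer (E j).R)) ∧
    (∀ ρ : ℝ, (∀ j, (E j).R < ρ) → IsCompact (⋃ j, (E j).toFun '' outer ρ)ᶜ) ∧
    (∀ j, 0 < α j) ∧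
    ∀ j i k, MemWeightedHolder (α j) (E j).R (-τ) a (coneError h (E j) (α j) i k)

/-! ### The flow -/

variable [IsManifold (𝓡 2) ∞ M]

/-- `u` is a (classical, positive) solution on `M × [0, ∞)` of
`∂ₜ u = Δ_{g₀} log u - R₀`, `u(0) = u₀`. The equation is required in all smooth local
coordinates. -/
structure IsSolution (g₀ : Metric M) (u₀ : M → ℝ) (u : ℝ → M → ℝ) : Prop where
  pos : ∀ t, 0 ≤ t → ∀ x, 0 < u t x
  initial : ∀ x, u 0 x = u₀ x
  continuousOn : ContinuousOn (fun p : ℝ × M => u p.1 p.2) (Ici 0 ×ˢ univ)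
  contMDiff : ∀ t, 0 < t → ContMDiff (𝓡 2) 𝓘(ℝ, ℝ) 2 (u t)
  equation : ∀ t, 0 < t → ∀ e ∈ IsManifold.maximalAtlas (𝓡 2) ∞ M, ∀ x ∈ e.source,
    HasDerivAt (fun s => u s x)
      (laplacianIn e g₀.inner (fun y => Real.log (u t y)) x - scalarCurvIn e g₀.inner x) t

/-- The scalar curvature of the metrics `u(t) g₀` is bounded on `M × (0, T]`, for every finite
`T`. -/
def HasBoundedCurvature (g₀ : Metric M) (u : ℝ → M → ℝ) : Prop :=
  ∀ T : ℝ, 0 < T → ∃ K : ℝ, ∀ t, 0 < t → t ≤ T →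
    ∀ e ∈ IsManifold.maximalAtlas (𝓡 2) ∞ M, ∀ x ∈ e.source,
      |scalarCurvIn e (conformal (u t) g₀.inner) x| ≤ K

end Surface

end ConicalRicci

end

/-! The equation has a scaling symmetry: if `u` is a solution and `l > 0`, then so is `l⁻¹ u(l t,
x)`, because `Δ log` does not see constant factors. For `l ≥ 1` the rescaled solution starts from
`l⁻¹ u₀ ≤ u₀`, so a comparison principle gives `u(l t, x) ≤ l u(t, x)`; that is, `u(t, x) / t` is
nonincreasing in `t`. Taking the right derivative at `l = 1` yields `∂ₜ u ≤ u / t`, and comparing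
time `t > 1` with time `1` yields linear growth.

The substance is the comparison principle on a noncompact surface (`IsSolution.le_of_initial_le`),
which needs two inputs.

Bounded curvature controls the solution. The conformal law `R(w g) = (R(g) - Δ log w) / w`
(`coordScalarCurv_smul`, `scalarCurvIn_conformal`) turns the equation into `∂ₜ u = -R(u g₀) u`. A
curvature bound `K` thus gives `|∂ₜ log u| ≤ K`, and hence two-sided bounds for `u` on finite time
intervals.

The conical ends provide a barrier (`exists_barrier`): a function equal to the radius `r` far out,
proper and with Laplacian bounded above. Subtracting a small multiple of it from `e^{-Kt} (log v -
log u)` forces a positive supremum to be attained. At that point the second derivative test in space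
and the sign of the time derivative contradict the equation. -/

namespace ConicalRicci

open Filter Topology Bundle

/-! ### Calculus of partial derivatives -/

section PartialDerivatives

variable {f g : Plane → ℝ} {y : Plane} {i j : Fin 2}

lemma pd_eq_of_hasFDerivAt {L : Plane →L[ℝ] ℝ} (h : HasFDerivAt f L y) :
    pd i f y = L (EuclideanSpace.single i 1) := by
  rw [pd, h.fderiv]

lemma pd_congr (h : f =ᶠ[𝓝 y] g) : pd i f y = pd i g y := by
  rw [pd, pd, h.fderiv_eq]

lemma pd_eventuallyEq (h : f =ᶠ[𝓝 y] g) : pd i f =ᶠ[𝓝 y] pd i g :=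
  h.eventuallyEq_nhds.mono fun _ hz => pd_congr hz

@[simp] lemma pd_const (c : ℝ) : pd i (fun _ => c) y = 0 := by
  simp [pd]

lemma pd_add (hf : DifferentiableAt ℝ f y) (hg : DifferentiableAt ℝ g y) :
    pd i (fun z => f z + g z) y = pd i f y + pd i g y := by
  rw [pd_eq_of_hasFDerivAt (hf.hasFDerivAt.fun_add hg.hasFDerivAt)]; rfl

lemma pd_sub (hf : DifferentiableAt ℝ f y) (hg : DifferentiableAt ℝ g y) :
    pd i (fun z => f z - g z) y = pd i f y - pd i g y := by
  rw [pd_eq_of_hasFDerivAt (hf.hasFDerivAt.fun_sub hg.hasFDerivAt)]; rfl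

lemma pd_mul (hf : DifferentiableAt ℝ f y) (hg : DifferentiableAt ℝ g y) :
    pd i (fun z => f z * g z) y = pd i f y * g y + f y * pd i g y := by
  rw [pd_eq_of_hasFDerivAt (hf.hasFDerivAt.fun_mul hg.hasFDerivAt)]
  simp [pd]; ring

lemma pd_const_mul (c : ℝ) (hf : DifferentiableAt ℝ f y) :
    pd i (fun z => c * f z) y = c * pd i f y := by
  rw [pd_mul (differentiableAt_const c) hf]; simp

lemma pd_sum {ι : Type*} (s : Finset ι) {F : ι → Plane → ℝ}
    (hF : ∀ k ∈ s, DifferentiableAt ℝ (F k) y) :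
    pd i (fun z => ∑ k ∈ s, F k z) y = ∑ k ∈ s, pd i (F k) y := by
  rw [pd_eq_of_hasFDerivAt (HasFDerivAt.fun_sum fun k hk => (hF k hk).hasFDerivAt)]
  simp [pd]

lemma pd_comp {φ : ℝ → ℝ} {φ' : ℝ} (hφ : HasDerivAt φ φ' (f y)) (hf : DifferentiableAt ℝ f y) :
    pd i (fun z => φ (f z)) y = φ' * pd i f y := by
  have := hφ.comp_hasFDerivAt y hf.hasFDerivAt
  rw [show (fun z => φ (f z)) = φ ∘ f from rfl, pd_eq_of_hasFDerivAt this]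
  simp [pd]

lemma pd_log (hf : DifferentiableAt ℝ f y) (h0 : f y ≠ 0) :
    pd i (fun z => Real.log (f z)) y = pd i f y / f y := by
  rw [pd_comp (Real.hasDerivAt_log h0) hf]; field_simp

lemma differentiableAt_coord (k : Fin 2) : DifferentiableAt ℝ (fun z : Plane => z k) y :=
  (EuclideanSpace.proj k : Plane →L[ℝ] ℝ).differentiableAt

lemma pd_coord (k : Fin 2) : pd i (fun z : Plane => z k) y = if k = i then 1 else 0 := by
  have h : HasFDerivAt (fun z : Plane => z k) (EuclideanSpace.proj k : Plane →L[ℝ] ℝ) y :=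
    (EuclideanSpace.proj k : Plane →L[ℝ] ℝ).hasFDerivAt
  rw [pd_eq_of_hasFDerivAt h]
  simp

lemma contDiffAt_pd (hf : ContDiffAt ℝ 2 f y) : ContDiffAt ℝ 1 (pd i f) y :=
  (hf.fderiv_right (m := 1) (by norm_num)).clm_apply contDiffAt_const

lemma differentiableAt_pd (hf : ContDiffAt ℝ 2 f y) : DifferentiableAt ℝ (pd i f) y :=
  (contDiffAt_pd hf).differentiableAt (by norm_num)

lemma fderiv_eq_sum_pd (v : Plane) : fderiv ℝ f y v = ∑ i, v i * pd i f y := by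
  have hv : v = ∑ i, v i • (EuclideanSpace.single i (1 : ℝ) : Plane) := by
    ext k; fin_cases k <;> simp [Fin.sum_univ_two]
  conv_lhs => rw [hv]
  simp [pd]

lemma pd_pd_eq (hf : ContDiffAt ℝ 2 f y) :
    pd i (pd j f) y = fderiv ℝ (fderiv ℝ f) y (EuclideanSpace.single i 1)
      (EuclideanSpace.single j 1) := by
  have h : DifferentiableAt ℝ (fderiv ℝ f) y :=
    (hf.fderiv_right (m := 1) (by norm_num)).differentiableAt (by norm_num)
  have h2 := h.hasFDerivAt.clm_apply
    (hasFDerivAt_const (EuclideanSpace.single j (1 : ℝ) : Plane) y)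
  rw [pd_eq_of_hasFDerivAt (f := pd j f) h2]
  simp

lemma pd_comm (hf : ContDiffAt ℝ 2 f y) : pd i (pd j f) y = pd j (pd i f) y := by
  rw [pd_pd_eq hf, pd_pd_eq hf]
  exact (hf.isSymmSndFDerivAt (by simp)) _ _

end PartialDerivatives

/-! ### The second derivative test -/

section SecondDerivativeTest

variable {f : Plane → ℝ} {y : Plane}

/-- A positive second derivative would make `t` a local minimum as well, so `γ` would be constant
near `t` and its second derivative would vanish. -/
lemma _root_.IsLocalMax.deriv_deriv_nonpos {γ : ℝ → ℝ} {t : ℝ} (h : IsLocalMax γ t)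
    (hc : ContinuousAt γ t) : deriv (deriv γ) t ≤ 0 := by
  by_contra! hpos
  have hmin := isLocalMin_of_deriv_deriv_pos hpos h.deriv_eq_zero hc
  have hconst : γ =ᶠ[𝓝 t] fun _ => γ t := by
    filter_upwards [h, hmin] with s h1 h2 using le_antisymm h1 h2
  have h3 : deriv γ =ᶠ[𝓝 t] deriv fun _ => γ t := hconst.deriv
  rw [h3.deriv_eq] at hpos
  simp at hpos

lemma _root_.IsLocalMax.pd_eq_zero (h : IsLocalMax f y) (i : Fin 2) : pd i f y = 0 := by
  rw [pd, h.fderiv_eq_zero]; rfl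

/-- The one-variable test applies to the restriction of `f` to the line through `y` in direction
`v`. -/
lemma _root_.IsLocalMax.hessian_nonpos (h : IsLocalMax f y) (hf : ContDiffAt ℝ 2 f y)
    (v : Fin 2 → ℝ) : ∑ i, ∑ j, v i * v j * pd i (pd j f) y ≤ 0 := by
  set w : Plane := WithLp.toLp 2 v
  have hline : Continuous fun t : ℝ => y + t • w := by fun_prop
  have hd : ∀ t : ℝ, HasDerivAt (fun t : ℝ => y + t • w) w t := fun t => by
    simpa using ((hasDerivAt_id t).smul_const w).const_add y
  have h0 : (fun t : ℝ => y + t • w) 0 = y := by simp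
  have htend : Tendsto (fun t : ℝ => y + t • w) (𝓝 0) (𝓝 y) := by
    simpa using hline.tendsto 0
  have hmax : IsLocalMax (fun t : ℝ => f (y + t • w)) 0 := by
    have := htend.eventually h
    simpa [IsLocalMax, IsMaxFilter] using this
  have hcont : ContinuousAt (fun t : ℝ => f (y + t • w)) 0 := by
    apply ContinuousAt.comp (f := fun t : ℝ => y + t • w) (g := f)
    · simpa using hf.continuousAt
    · exact hline.continuousAt
  have hdiff : ∀ᶠ z in 𝓝 y, DifferentiableAt ℝ f z := by
    have := hf.eventually (by simp)
    exact this.mono fun z hz => hz.differentiableAt (by norm_num)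
  have hder : deriv (fun t : ℝ => f (y + t • w)) =ᶠ[𝓝 0]
      fun t => ∑ j, v j * pd j f (y + t • w) := by
    filter_upwards [htend.eventually hdiff] with t ht
    have := ht.hasFDerivAt.comp_hasDerivAt t (hd t)
    rw [show (fun t : ℝ => f (y + t • w)) = f ∘ fun t : ℝ => y + t • w from rfl, this.deriv,
      fderiv_eq_sum_pd]
  have key := hmax.deriv_deriv_nonpos hcont
  rw [hder.deriv_eq] at key
  have h2 : HasDerivAt (fun t : ℝ => ∑ j, v j * pd j f (y + t • w))
      (∑ j, v j * ∑ i, v i * pd i (pd j f) y) 0 := by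
    apply HasDerivAt.fun_sum
    intro j _
    apply HasDerivAt.const_mul
    have hp : HasFDerivAt (pd j f) (fderiv ℝ (pd j f) y) (y + (0 : ℝ) • w) := by
      simpa using (differentiableAt_pd (i := j) hf).hasFDerivAt
    have := hp.comp_hasDerivAt (0 : ℝ) (hd 0)
    rw [fderiv_eq_sum_pd] at this
    exact this
  rw [h2.deriv] at key
  simp only [Fin.sum_univ_two] at key ⊢
  linarith

end SecondDerivativeTest

/-! ### The Laplacian at a maximum -/

/-- The Christoffel terms drop out at a critical point, leaving the trace of a nonpositive Hessian
against the positive definite matrix `G⁻¹`. -/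
lemma coordLaplacian_nonpos_of_isLocalMax {G : Plane → Matrix (Fin 2) (Fin 2) ℝ} {f : Plane → ℝ}
    {y : Plane} (hG : (G y).PosDef) (hf : ContDiffAt ℝ 2 f y) (h : IsLocalMax f y) :
    coordLaplacian G f y ≤ 0 := by
  have hQ : ((G y)⁻¹).PosDef := hG.inv
  simp only [coordLaplacian, h.pd_eq_zero, mul_zero, Finset.sum_const_zero, sub_zero]
  have h00 : 0 < (G y)⁻¹ 0 0 := hQ.diag_pos
  have hdet : 0 < ((G y)⁻¹).det := hQ.det_pos
  have hsym : (G y)⁻¹ 0 1 = (G y)⁻¹ 1 0 := by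
    simpa using (hQ.isHermitian.apply 0 1).symm
  generalize (G y)⁻¹ = Q at *
  rw [Matrix.det_fin_two] at hdet
  have h1 := h.hessian_nonpos hf (Q 0)
  have h2 := h.hessian_nonpos hf ![0, 1]
  have hc := pd_comm (i := 0) (j := 1) hf
  simp only [Fin.sum_univ_two, Matrix.cons_val_zero, Matrix.cons_val_one] at h1 h2 ⊢
  rw [hc] at h1 ⊢
  rw [← hsym] at hdet ⊢
  -- Completing the square: with `H` the Hessian, `Q₀₀ tr(Q H) = H(Q₀, Q₀) + det Q · H₁₁`, where
  -- `Q₀` is the first row of `Q`.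
  have h3 : Q 0 0 * (Q 0 0 * pd 0 (pd 0 f) y + Q 0 1 * pd 1 (pd 0 f) y +
      (Q 0 1 * pd 1 (pd 0 f) y + Q 1 1 * pd 1 (pd 1 f) y)) ≤ 0 := by
    have h2' : pd 1 (pd 1 f) y ≤ 0 := by simpa using h2
    nlinarith [mul_nonneg hdet.le (neg_nonneg.2 h2')]
  exact nonpos_of_mul_nonpos_right h3 h00

lemma coordLaplacian_congr {G : Plane → Matrix (Fin 2) (Fin 2) ℝ} {f g : Plane → ℝ} {y : Plane}
    (h : f =ᶠ[𝓝 y] g) : coordLaplacian G f y = coordLaplacian G g y := by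
  simp only [coordLaplacian, pd_congr h, pd_congr (pd_eventuallyEq h)]

lemma coordLaplacian_congr_metric {G H : Plane → Matrix (Fin 2) (Fin 2) ℝ} {f : Plane → ℝ}
    {y : Plane} (h : G =ᶠ[𝓝 y] H) : coordLaplacian G f y = coordLaplacian H f y := by
  have hij : ∀ i j, (fun z => G z i j) =ᶠ[𝓝 y] fun z => H z i j := fun i j =>
    h.mono fun z hz => by simp only [hz]
  simp only [coordLaplacian, christoffel, h.self_of_nhds, pd_congr (hij _ _)]

lemma coordLaplacian_add {G : Plane → Matrix (Fin 2) (Fin 2) ℝ} {f g : Plane → ℝ} {y : Plane}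
    (hf : ContDiffAt ℝ 2 f y) (hg : ContDiffAt ℝ 2 g y) :
    coordLaplacian G (fun z => f z + g z) y = coordLaplacian G f y + coordLaplacian G g y := by
  have h1 : ∀ j, pd j (fun z => f z + g z) =ᶠ[𝓝 y] fun z => pd j f z + pd j g z := fun j => by
    filter_upwards [hf.eventually (by simp), hg.eventually (by simp)] with z h1 h2
    exact pd_add (h1.differentiableAt (by norm_num)) (h2.differentiableAt (by norm_num))
  simp only [coordLaplacian, (h1 _).self_of_nhds, pd_congr (h1 _),
    pd_add (differentiableAt_pd hf) (differentiableAt_pd hg), Fin.sum_univ_two]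
  ring

lemma coordLaplacian_const_mul {G : Plane → Matrix (Fin 2) (Fin 2) ℝ} {f : Plane → ℝ} {y : Plane}
    (c : ℝ) (hf : ContDiffAt ℝ 2 f y) :
    coordLaplacian G (fun z => c * f z) y = c * coordLaplacian G f y := by
  have h1 : ∀ j, pd j (fun z => c * f z) =ᶠ[𝓝 y] fun z => c * pd j f z := fun j => by
    filter_upwards [hf.eventually (by simp)] with z h1
    exact pd_const_mul c (h1.differentiableAt (by norm_num))
  simp only [coordLaplacian, (h1 _).self_of_nhds, pd_congr (h1 _),
    pd_const_mul c (differentiableAt_pd hf), Fin.sum_univ_two]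
  ring

/-! ### Conformal change of the scalar curvature -/

/-- The pointwise algebra of the conformal law. `Q` stands for `G⁻¹`, `L` and `LL` for the first and
second derivatives of `log w`, `E` for the difference of the two connections and `dE` for its
derivatives. The terms quadratic in `L` cancel because the dimension is two. -/
lemma conformal_trace_identity (G Q : Fin 2 → Fin 2 → ℝ) (hGs : ∀ i j, G i j = G j i)
    (hQs : ∀ i j, Q i j = Q j i) (hQG : ∀ i j, ∑ k, Q i k * G k j = if i = j then 1 else 0)
    (Γ : Fin 2 → Fin 2 → Fin 2 → ℝ) (hΓ : ∀ k i j, Γ k i j = Γ k j i)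
    (L : Fin 2 → ℝ) (LL : Fin 2 → Fin 2 → ℝ) (hLL : ∀ i j, LL i j = LL j i)
    (dE : Fin 2 → Fin 2 → Fin 2 → Fin 2 → ℝ)
    (dG dQ : Fin 2 → Fin 2 → Fin 2 → ℝ)
    (hdG : ∀ m i j, dG m i j = ∑ l, (G l j * Γ l m i + G i l * Γ l m j))
    (hdQ : ∀ m i j, dQ m i j = -∑ l, (Γ i m l * Q l j + Γ j m l * Q i l))
    (E : Fin 2 → Fin 2 → Fin 2 → ℝ)
    (hE : ∀ k i j, E k i j = (1 / 2) * ((if k = i then L j else 0) + (if k = j then L i else 0)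
      - G i j * ∑ l, Q k l * L l))
    (hdE : ∀ m k i j, dE m k i j = (1 / 2) * ((if k = i then LL m j else 0) +
      (if k = j then LL m i else 0)
      - (dG m i j * ∑ l, Q k l * L l + G i j * ∑ l, (dQ m k l * L l + Q k l * LL m l)))) :
    ∑ i, ∑ j, Q i j * (∑ k, (dE k k i j - dE j k i k) + ∑ k, ∑ l,
      (Γ k k l * E l i j + E k k l * Γ l i j + E k k l * E l i j
       - (Γ k j l * E l i k + E k j l * Γ l i k + E k j l * E l i k))) =
    - ∑ i, ∑ j, Q i j * (LL i j - ∑ k, Γ k i j * L k) := by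
  have h1 := hQG 0 0
  have h2 := hQG 0 1
  have h3 := hQG 1 0
  have h4 := hQG 1 1
  have g0 := hΓ 0 1 0
  have g1 := hΓ 1 1 0
  have l0 := hLL 1 0
  have m0 := hGs 1 0
  have q0 := hQs 1 0
  simp only [hdE, hdG, hdQ, hE, Fin.sum_univ_two, if_true, one_ne_zero, zero_ne_one, if_false,
    g0, g1, l0, m0, q0] at h1 h2 h3 h4 ⊢
  clear hdE hdG hdQ hE hQG hΓ hLL hGs hQs m0 q0 g0 g1 l0
  generalize G 0 0 = a at *
  generalize G 0 1 = b at *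
  generalize G 1 1 = c at *
  generalize Q 0 0 = p at *
  generalize Q 0 1 = q at *
  generalize Q 1 1 = r at *
  -- Once `Q` is eliminated by Cramer's rule, the claim is a rational identity in independent
  -- variables.
  have hd : a * c - b * b ≠ 0 := by
    intro h
    have : (p * r - q * q) * (a * c - b * b) = 1 := by
      linear_combination h1 * (q * b + r * c) + h4 - h2 * (q * a + r * b)
    rw [h] at this; simp at this
  have hp : p = c / (a * c - b * b) := by
    rw [eq_div_iff hd]; linear_combination c * h1 - b * h2
  have hq : q = - b / (a * c - b * b) := by
    rw [eq_div_iff hd]; linear_combination a * h2 - b * h1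
  have hr : r = a / (a * c - b * b) := by
    rw [eq_div_iff hd]; linear_combination a * h4 - b * h3
  clear h1 h2 h3 h4
  generalize hdd : a * c - b * b = d at *
  subst hp hq hr
  field_simp
  rw [← hdd]
  ring

section Conformal

variable {G : Plane → Matrix (Fin 2) (Fin 2) ℝ} {y : Plane}

lemma posDef_symm {A : Matrix (Fin 2) (Fin 2) ℝ} (hA : A.PosDef) (i j : Fin 2) :
    A i j = A j i := by
  simpa using (hA.isHermitian.apply i j).symm

lemma posDef_inv_mul {A : Matrix (Fin 2) (Fin 2) ℝ} (hA : A.PosDef) : A⁻¹ * A = 1 :=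
  Matrix.nonsing_inv_mul _ hA.det_pos.ne'.isUnit

lemma posDef_mul_inv {A : Matrix (Fin 2) (Fin 2) ℝ} (hA : A.PosDef) : A * A⁻¹ = 1 :=
  Matrix.mul_nonsing_inv _ hA.det_pos.ne'.isUnit

lemma contDiffAt_inv_apply (hG : ∀ i j, ContDiffAt ℝ 2 (fun z => G z i j) y)
    (hpos : (G y).PosDef) (k l : Fin 2) : ContDiffAt ℝ 2 (fun z => (G z)⁻¹ k l) y := by
  have hdet : ContDiffAt ℝ 2 (fun z => (G z).det) y := by
    simp only [Matrix.det_fin_two]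
    exact ((hG 0 0).mul (hG 1 1)).sub ((hG 0 1).mul (hG 1 0))
  have hinv : ContDiffAt ℝ 2 (fun z => ((G z).det)⁻¹) y := hdet.inv hpos.det_pos.ne'
  simp only [Matrix.inv_def, Ring.inverse_eq_inv', Matrix.adjugate_fin_two, Matrix.smul_apply,
    smul_eq_mul]
  apply hinv.mul
  fin_cases k <;> fin_cases l
  · exact hG 1 1
  · exact (hG 0 1).neg
  · exact (hG 1 0).neg
  · exact hG 0 0

lemma contDiffAt_christoffel (hG : ∀ i j, ContDiffAt ℝ 2 (fun z => G z i j) y)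
    (hpos : (G y).PosDef) (k i j : Fin 2) : ContDiffAt ℝ 1 (christoffel G k i j) y := by
  unfold christoffel
  apply ContDiffAt.sum
  intro l _
  exact (contDiffAt_const.mul ((contDiffAt_inv_apply hG hpos k l).of_le (by norm_num))).mul
    (((contDiffAt_pd (hG j l)).add (contDiffAt_pd (hG i l))).sub (contDiffAt_pd (hG i j)))

lemma christoffel_symm (hs : ∀ᶠ z in 𝓝 y, (G z).PosDef) (k i j : Fin 2) :
    christoffel G k i j y = christoffel G k j i y := by
  have : (fun z => G z i j) =ᶠ[𝓝 y] fun z => G z j i := hs.mono fun z hz => posDef_symm hz i j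
  simp only [christoffel, pd_congr this]
  exact Finset.sum_congr rfl fun l _ => by ring

/-- Metric compatibility of the Levi-Civita connection, `∇G = 0`. -/
lemma pd_metric_eq (hs : ∀ᶠ z in 𝓝 y, (G z).PosDef) (m i j : Fin 2) :
    pd m (fun z => G z i j) y =
      ∑ l, (G y l j * christoffel G l m i y + G y i l * christoffel G l m j y) := by
  have hpos := hs.self_of_nhds
  have hmul := posDef_mul_inv hpos
  -- Lowering the upper index recovers the Christoffel symbols of the first kind; two of these add
  -- up to `∂ₘ Gᵢⱼ`.
  have hlow : ∀ a b c, ∑ l, G y c l * christoffel G l a b y = (1 / 2) *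
      (pd a (fun z => G z b c) y + pd b (fun z => G z a c) y - pd c (fun z => G z a b) y) := by
    intro a b c
    have : ∀ p, ∑ l, G y c l * (G y)⁻¹ l p = if c = p then 1 else 0 := fun p => by
      rw [← Matrix.mul_apply, hmul, Matrix.one_apply]
    have h0 := this 0
    have h1 := this 1
    simp only [christoffel, Fin.sum_univ_two] at h0 h1 ⊢
    set X0 := pd a (fun z => G z b 0) y + pd b (fun z => G z a 0) y - pd 0 (fun z => G z a b) y
    set X1 := pd a (fun z => G z b 1) y + pd b (fun z => G z a 1) y - pd 1 (fun z => G z a b) y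
    calc _ = (1 / 2) * (X0 * (if c = 0 then 1 else 0) + X1 * (if c = 1 then 1 else 0)) := by
          linear_combination (1 / 2) * X0 * h0 + (1 / 2) * X1 * h1
      _ = _ := by fin_cases c <;> simp [X0, X1]
  have hsym : ∀ a b c, pd a (fun z => G z b c) y = pd a (fun z => G z c b) y := fun a b c =>
    pd_congr (hs.mono fun z hz => posDef_symm hz b c)
  rw [Finset.sum_add_distrib, hlow]
  simp only [posDef_symm hpos _ j]
  rw [hlow, hsym j m i, hsym i m j, hsym m j i]
  ring

/-- Differentiating `G⁻¹ G = 1` gives `∂(G⁻¹) = -G⁻¹ (∂G) G⁻¹`, into which metric compatibility is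
inserted. -/
lemma pd_inv_eq (hG : ∀ i j, ContDiffAt ℝ 2 (fun z => G z i j) y)
    (hs : ∀ᶠ z in 𝓝 y, (G z).PosDef) (m i j : Fin 2) :
    pd m (fun z => (G z)⁻¹ i j) y =
      -∑ l, (christoffel G i m l y * (G y)⁻¹ l j + christoffel G j m l y * (G y)⁻¹ i l) := by
  have hpos := hs.self_of_nhds
  set Q := (G y)⁻¹ with hQ
  set Γ : Matrix (Fin 2) (Fin 2) ℝ := Matrix.of fun p k => christoffel G p m k y with hΓ
  set DG : Matrix (Fin 2) (Fin 2) ℝ := Matrix.of fun i j => pd m (fun z => G z i j) y with hDG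
  set DQ : Matrix (Fin 2) (Fin 2) ℝ := Matrix.of fun i j => pd m (fun z => (G z)⁻¹ i j) y with hDQ
  have h1 : DG = Γ.transpose * G y + G y * Γ := by
    ext a b
    simp only [hDG, hΓ, Matrix.of_apply, pd_metric_eq hs, Matrix.add_apply, Matrix.mul_apply,
      Matrix.transpose_apply, Finset.sum_add_distrib]
    simp only [mul_comm]
  have h2 : DQ * G y + Q * DG = 0 := by
    ext a b
    have hc : (fun z => ∑ k, (G z)⁻¹ a k * G z k b) =ᶠ[𝓝 y]
        fun _ => (1 : Matrix (Fin 2) (Fin 2) ℝ) a b := by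
      filter_upwards [hs] with z hz
      rw [← Matrix.mul_apply, posDef_inv_mul hz]
    have hd1 : ∀ k, DifferentiableAt ℝ (fun z => (G z)⁻¹ a k) y := fun k =>
      (contDiffAt_inv_apply hG hpos a k).differentiableAt (by norm_num)
    have hd2 : ∀ k, DifferentiableAt ℝ (fun z => G z k b) y := fun k =>
      (hG k b).differentiableAt (by norm_num)
    have h3 := pd_congr (i := m) hc
    rw [pd_const, pd_sum _ fun k _ => (hd1 k).fun_mul (hd2 k)] at h3
    simp only [pd_mul (hd1 _) (hd2 _), Finset.sum_add_distrib] at h3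
    simpa [hDQ, hDG, Matrix.mul_apply] using h3
  have hGQ : G y * Q = 1 := posDef_mul_inv hpos
  have hQG : Q * G y = 1 := posDef_inv_mul hpos
  have h3 : DQ = -(Γ * Q + Q * Γ.transpose) := by
    calc DQ = DQ * (G y * Q) := by rw [hGQ, mul_one]
      _ = (DQ * G y) * Q := by rw [mul_assoc]
      _ = (-(Q * DG)) * Q := by rw [eq_neg_of_add_eq_zero_left h2]
      _ = -(Q * Γ.transpose * (G y * Q) + (Q * G y) * Γ * Q) := by rw [h1]; noncomm_ring
      _ = _ := by rw [hGQ, hQG, mul_one, one_mul, add_comm]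
  have h4 := congrFun (congrFun h3 i) j
  simp only [hDQ, hΓ, Matrix.of_apply, Matrix.neg_apply, Matrix.add_apply, Matrix.mul_apply,
    Matrix.transpose_apply] at h4
  rw [h4, Finset.sum_add_distrib]
  simp only [mul_comm]

/-- The difference of the Christoffel symbols of `w G` and `G`, where `L = log w`. -/
noncomputable def conformalDiff (G : Plane → Matrix (Fin 2) (Fin 2) ℝ) (L : Plane → ℝ)
    (k i j : Fin 2) (y : Plane) : ℝ :=
  (1 / 2) * ((if k = i then pd j L y else 0) + (if k = j then pd i L y else 0)
      - G y i j * ∑ l, (G y)⁻¹ k l * pd l L y)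

variable {w : Plane → ℝ}

lemma christoffel_smul (hG : ∀ i j, DifferentiableAt ℝ (fun z => G z i j) y)
    (hs : (G y).PosDef) (hw : DifferentiableAt ℝ w y) (hpos : 0 < w y) (k i j : Fin 2) :
    christoffel (fun z => w z • G z) k i j y =
      christoffel G k i j y + conformalDiff G (fun z => Real.log (w z)) k i j y := by
  have hinv : (w y • G y)⁻¹ = (w y)⁻¹ • (G y)⁻¹ := by
    apply Matrix.inv_eq_left_inv
    rw [Matrix.smul_mul, Matrix.mul_smul, posDef_inv_mul hs, smul_smul, inv_mul_cancel₀ hpos.ne',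
      one_smul]
  have hδ : ∀ p, ∑ l, (G y)⁻¹ k l * G y p l = if k = p then 1 else 0 := fun p => by
    simp only [posDef_symm hs p]
    rw [← Matrix.mul_apply, posDef_inv_mul hs, Matrix.one_apply]
  have hi := hδ i
  have hj := hδ j
  simp only [christoffel, conformalDiff, hinv, Matrix.smul_apply, smul_eq_mul, pd_mul hw (hG _ _),
    pd_log hw hpos.ne', Fin.sum_univ_two] at hi hj ⊢
  rw [show ∀ x : ℝ, (if k = i then x else 0) = (if k = i then 1 else 0) * x by intro x; simp,
    show ∀ x : ℝ, (if k = j then x else 0) = (if k = j then 1 else 0) * x by intro x; simp,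
    ← hi, ← hj]
  field_simp
  ring

lemma differentiableAt_sum_inv_pd (hG : ∀ i j, ContDiffAt ℝ 2 (fun z => G z i j) y)
    (hs : (G y).PosDef) {L : Plane → ℝ} (hL : ContDiffAt ℝ 2 L y) (k : Fin 2) :
    DifferentiableAt ℝ (fun z => ∑ l, (G z)⁻¹ k l * pd l L z) y :=
  DifferentiableAt.fun_sum fun l _ =>
    ((contDiffAt_inv_apply hG hs k l).differentiableAt (by norm_num)).mul (differentiableAt_pd hL)

lemma differentiableAt_ite_pd {L : Plane → ℝ} (hL : ContDiffAt ℝ 2 L y) (k i j : Fin 2) :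
    DifferentiableAt ℝ (fun z => if k = i then pd j L z else 0) y := by
  split_ifs
  · exact differentiableAt_pd hL
  · exact differentiableAt_const _

lemma differentiableAt_conformalDiff (hG : ∀ i j, ContDiffAt ℝ 2 (fun z => G z i j) y)
    (hs : (G y).PosDef) {L : Plane → ℝ} (hL : ContDiffAt ℝ 2 L y) (k i j : Fin 2) :
    DifferentiableAt ℝ (conformalDiff G L k i j) y :=
  (((differentiableAt_ite_pd hL k i j).add (differentiableAt_ite_pd hL k j i)).sub
    (((hG i j).differentiableAt (by norm_num)).mul
      (differentiableAt_sum_inv_pd hG hs hL k))).const_mul _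

lemma pd_conformalDiff (hG : ∀ i j, ContDiffAt ℝ 2 (fun z => G z i j) y)
    (hs : (G y).PosDef) {L : Plane → ℝ} (hL : ContDiffAt ℝ 2 L y) (m k i j : Fin 2) :
    pd m (conformalDiff G L k i j) y = (1 / 2) * ((if k = i then pd m (pd j L) y else 0) +
      (if k = j then pd m (pd i L) y else 0)
      - (pd m (fun z => G z i j) y * ∑ l, (G y)⁻¹ k l * pd l L y +
        G y i j * ∑ l, (pd m (fun z => (G z)⁻¹ k l) y * pd l L y +
          (G y)⁻¹ k l * pd m (pd l L) y))) := by
  have h1 := differentiableAt_ite_pd hL k i j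
  have h2 := differentiableAt_ite_pd hL k j i
  have h3 := differentiableAt_sum_inv_pd hG hs hL k
  have h4 : DifferentiableAt ℝ (fun z => G z i j) y := (hG i j).differentiableAt (by norm_num)
  have h5 : ∀ l, DifferentiableAt ℝ (fun z => (G z)⁻¹ k l) y := fun l =>
    (contDiffAt_inv_apply hG hs k l).differentiableAt (by norm_num)
  have h6 : ∀ p q r : Fin 2, pd m (fun z => if p = q then pd r L z else 0) y =
      if p = q then pd m (pd r L) y else 0 := fun p q r => by
    split_ifs
    · rfl
    · exact pd_const 0
  unfold conformalDiff
  rw [pd_const_mul _ ((h1.fun_add h2).fun_sub (h4.fun_mul h3)),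
    pd_sub (h1.fun_add h2) (h4.fun_mul h3),
    pd_add h1 h2, pd_mul h4 h3, pd_sum _ fun l _ => (h5 l).fun_mul (differentiableAt_pd hL), h6, h6]
  simp only [pd_mul (h5 _) (differentiableAt_pd hL)]

/-- Substituting `Γ + E` for the Christoffel symbols in the Ricci tensor, the terms free of `E` give
the curvature of `G`, and the trace of the others is `-Δ log w` by `conformal_trace_identity`. -/
theorem coordScalarCurv_smul (hG : ∀ i j, ContDiffAt ℝ 2 (fun z => G z i j) y)
    (hs : ∀ᶠ z in 𝓝 y, (G z).PosDef) (hw : ContDiffAt ℝ 2 w y) (hpos : ∀ z, 0 < w z) :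
    coordScalarCurv (fun z => w z • G z) y =
      (coordScalarCurv G y - coordLaplacian G (fun z => Real.log (w z)) y) / w y := by
  have hs0 := hs.self_of_nhds
  set L : Plane → ℝ := fun z => Real.log (w z) with hLdef
  have hL : ContDiffAt ℝ 2 L y := hw.log (hpos y).ne'
  -- Equality is needed near `y`, not only at `y`, since the Christoffel symbols get differentiated.
  have hΓev : ∀ k i j, christoffel (fun z => w z • G z) k i j =ᶠ[𝓝 y]
      fun z => christoffel G k i j z + conformalDiff G L k i j z := fun k i j => by
    have hGe : ∀ᶠ z in 𝓝 y, ∀ i j, ContDiffAt ℝ 2 (fun z => G z i j) z := by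
      rw [eventually_all]; intro i; rw [eventually_all]; intro j
      exact (hG i j).eventually (by simp)
    filter_upwards [hGe, hs, hw.eventually (by simp)] with z h1 h2 h3
    exact christoffel_smul (fun i j => (h1 i j).differentiableAt (by norm_num)) h2
      (h3.differentiableAt (by norm_num)) (hpos z) k i j
  have hinv : (w y • G y)⁻¹ = (w y)⁻¹ • (G y)⁻¹ := by
    apply Matrix.inv_eq_left_inv
    rw [Matrix.smul_mul, Matrix.mul_smul, posDef_inv_mul hs0, smul_smul,
      inv_mul_cancel₀ (hpos y).ne', one_smul]
  have hΓd : ∀ k i j, DifferentiableAt ℝ (christoffel G k i j) y := fun k i j =>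
    (contDiffAt_christoffel hG hs0 k i j).differentiableAt (by norm_num)
  have key := conformal_trace_identity (fun i j => G y i j) (fun i j => (G y)⁻¹ i j)
    (posDef_symm hs0) (posDef_symm hs0.inv)
    (fun i j => by rw [← Matrix.mul_apply, posDef_inv_mul hs0, Matrix.one_apply])
    (fun k i j => christoffel G k i j y) (fun k i j => christoffel_symm hs k i j)
    (fun i => pd i L y) (fun i j => pd i (pd j L) y) (fun i j => pd_comm hL)
    (fun m k i j => pd m (conformalDiff G L k i j) y) (fun m i j => pd m (fun z => G z i j) y)
    (fun m i j => pd m (fun z => (G z)⁻¹ i j) y) (fun m i j => pd_metric_eq hs m i j)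
    (fun m i j => pd_inv_eq hG hs m i j) (fun k i j => conformalDiff G L k i j y)
    (fun k i j => rfl) (fun m k i j => pd_conformalDiff hG hs0 hL m k i j)
  have hpd : ∀ m k i j, pd m (christoffel (fun z => w z • G z) k i j) y =
      pd m (christoffel G k i j) y + pd m (conformalDiff G L k i j) y := fun m k i j => by
    rw [pd_congr (hΓev k i j)]
    exact pd_add (hΓd k i j) (differentiableAt_conformalDiff hG hs0 hL k i j)
  rw [eq_div_iff (hpos y).ne', coordLaplacian, sub_eq_add_neg, ← key]
  simp only [coordScalarCurv, coordRicci, hinv, Matrix.smul_apply, smul_eq_mul, hpd,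
    (hΓev _ _ _).self_of_nhds]
  have hwne := (hpos y).ne'
  simp only [Finset.sum_mul, ← Finset.sum_add_distrib]
  refine Finset.sum_congr rfl fun i _ => Finset.sum_congr rfl fun j _ => ?_
  rw [show ∀ a b : ℝ, (w y)⁻¹ * a * b * w y = a * b by intro a b; field_simp, ← mul_add]
  congr 1
  simp only [Fin.sum_univ_two]
  ring

end Conformal

/-! ### Metrics on a surface in coordinates -/

section Charts

variable {M : Type*} [TopologicalSpace M] [ChartedSpace Plane M]
  {e : OpenPartialHomeomorph M Plane}

lemma contMDiffAt_chart_symm_of_mem (he : e ∈ IsManifold.maximalAtlas (𝓡 2) ∞ M) {y : Plane}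
    (hy : y ∈ e.target) : ContMDiffAt (𝓡 2) (𝓡 2) ∞ e.symm y :=
  contMDiffAt_symm_of_mem_maximalAtlas he hy

lemma contDiffAt_comp_chart_symm (he : e ∈ IsManifold.maximalAtlas (𝓡 2) ∞ M) {y : Plane}
    (hy : y ∈ e.target) {f : M → ℝ} (hf : ContMDiff (𝓡 2) 𝓘(ℝ, ℝ) 2 f) :
    ContDiffAt ℝ 2 (f ∘ e.symm) y := by
  have h1 : ContMDiffAt (𝓡 2) (𝓡 2) 2 e.symm y :=
    (contMDiffAt_chart_symm_of_mem he hy).of_le (WithTop.coe_le_coe.2 le_top)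
  exact (ContMDiffAt.comp y hf.contMDiffAt h1).contDiffAt

variable [IsManifold (𝓡 2) ∞ M]

/-- The field is the tangent map of `e.symm` applied to a constant vector field; one derivative is
lost, so `C³` regularity of `e.symm` suffices. -/
lemma contMDiffAt_coordinateField (he : e ∈ IsManifold.maximalAtlas (𝓡 2) ∞ M) {y : Plane}
    (hy : y ∈ e.target) (v : Plane) :
    ContMDiffAt (𝓡 2) ((𝓡 2).prod 𝓘(ℝ, Plane)) 2
      (fun z => TotalSpace.mk' Plane (E := fun x : M => TangentSpace (𝓡 2) x) (e.symm z)
        (mfderiv (𝓡 2) (𝓡 2) e.symm z v)) y := by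
  have : IsManifold (𝓡 2) 1 M := IsManifold.of_le (n := ∞) (by exact_mod_cast le_top)
  have h1 : ContMDiffOn (𝓡 2) (𝓡 2) 3 e.symm e.target :=
    (contMDiffOn_symm_of_mem_maximalAtlas he).of_le (WithTop.coe_le_coe.2 le_top)
  have h2 := h1.contMDiffOn_tangentMapWithin (m := 2) (by norm_num) e.open_target.uniqueMDiffOn
  have h3 : ContMDiff (𝓡 2) ((𝓡 2).prod 𝓘(ℝ, Plane)) 2
      (fun z : Plane => (⟨z, v⟩ : TangentBundle (𝓡 2) Plane)) := by
    exact contMDiff_vectorSpace_iff_contDiff (V := fun _ : Plane => v).2 contDiff_const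
  have h4 := h2.comp (s := e.target) h3.contMDiffOn (fun z hz => hz)
  refine (h4.contMDiffAt (e.open_target.mem_nhds hy)).congr_of_eventuallyEq ?_
  filter_upwards [e.open_target.mem_nhds hy] with z hz
  simp only [Function.comp, tangentMapWithin, mfderivWithin_of_isOpen e.open_target hz]

lemma contDiffAt_pullback (he : e ∈ IsManifold.maximalAtlas (𝓡 2) ∞ M) {y : Plane}
    (hy : y ∈ e.target) (g : Metric M) (i j : Fin 2) :
    ContDiffAt ℝ 2 (fun z => pullback g.inner e.symm z i j) y := by
  have hb : ContMDiffAt (𝓡 2) (𝓡 2) 2 e.symm y :=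
    (contMDiffAt_chart_symm_of_mem he hy).of_le (WithTop.coe_le_coe.2 le_top)
  have : ContMDiffAt (𝓡 2) ((𝓡 2).prod 𝓘(ℝ, ℝ)) 2
      (fun z ↦ TotalSpace.mk' ℝ (E := Bundle.Trivial M ℝ) (e.symm z)
        (pullback g.inner e.symm z i j)) y := by
    apply ContMDiffAt.clm_bundle_apply₂ (F₁ := Plane) (F₂ := Plane)
    · exact ContMDiffAt.comp y g.contMDiff.contMDiffAt hb
    · exact contMDiffAt_coordinateField he hy _
    · exact contMDiffAt_coordinateField he hy _
  simp only [contMDiffAt_totalSpace] at this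
  exact this.2.contDiffAt

lemma posDef_pullback (he : e ∈ IsManifold.maximalAtlas (𝓡 2) ∞ M) {y : Plane}
    (hy : y ∈ e.target) (g : Metric M) : (pullback g.inner e.symm y).PosDef := by
  have hmd : e.MDifferentiable (𝓡 2) (𝓡 2) :=
    ⟨(contMDiffOn_of_mem_maximalAtlas he).mdifferentiableOn (by simp),
      (contMDiffOn_symm_of_mem_maximalAtlas he).mdifferentiableOn (by simp)⟩
  have hinj : Function.Injective (mfderiv (𝓡 2) (𝓡 2) e.symm y) := hmd.symm.mfderiv_injective hy
  set A : Plane →L[ℝ] TangentSpace (𝓡 2) (e.symm y) := mfderiv (𝓡 2) (𝓡 2) e.symm y with hA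
  have hentry : ∀ i j, pullback g.inner e.symm y i j = g.inner (e.symm y)
      (A (EuclideanSpace.single i (1 : ℝ))) (A (EuclideanSpace.single j (1 : ℝ))) :=
    fun i j => rfl
  refine Matrix.PosDef.of_dotProduct_mulVec_pos ?_ ?_
  · ext i j
    simp only [Matrix.conjTranspose_apply, star_trivial, hentry]
    exact g.symm _ _ _
  · intro v hv
    set w : Plane := WithLp.toLp 2 v with hw
    have hw0 : w ≠ 0 := by
      intro h
      apply hv
      ext i
      have := congrArg (fun z : Plane => z i) h
      simpa [hw] using this
    have hAw : A w ≠ 0 := by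
      intro h
      exact hw0 (hinj (h.trans A.map_zero.symm))
    have hdec : w = v 0 • (EuclideanSpace.single 0 (1 : ℝ) : Plane) +
        v 1 • (EuclideanSpace.single 1 (1 : ℝ) : Plane) := by
      ext k; fin_cases k <;> simp [hw]
    have := g.pos (e.symm y) (A w) hAw
    rw [hdec] at this
    simp only [map_add, map_smul, add_apply, smul_apply,
      smul_eq_mul, ← hentry] at this
    simp only [dotProduct, Matrix.mulVec, Fin.sum_univ_two, star_trivial]
    linarith

/-- Together with the flow equation this says `∂ₜ u = -R(u g₀) u`, the link between the curvature
hypothesis and the logarithmic derivative of `u`. -/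
theorem scalarCurvIn_conformal (he : e ∈ IsManifold.maximalAtlas (𝓡 2) ∞ M) {x : M}
    (hx : x ∈ e.source) (g : Metric M) {w : M → ℝ} (hw : ContMDiff (𝓡 2) 𝓘(ℝ, ℝ) 2 w)
    (hpos : ∀ x, 0 < w x) :
    scalarCurvIn e (conformal w g.inner) x = (scalarCurvIn e g.inner x -
      laplacianIn e g.inner (fun z => Real.log (w z)) x) / w x := by
  have hy : e x ∈ e.target := e.map_source hx
  have h := coordScalarCurv_smul (w := w ∘ e.symm) (contDiffAt_pullback he hy g)
    (by filter_upwards [e.open_target.mem_nhds hy] with z hz using posDef_pullback he hz g)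
    (contDiffAt_comp_chart_symm he hy hw) fun z => hpos _
  have h2 : w (e.symm (e x)) = w x := by rw [e.left_inv hx]
  simp only [Function.comp, h2] at h
  exact h

end Charts

/-- Polar coordinates are local coordinates. -/
lemma PolarEnd.exists_chart {M : Type*} [TopologicalSpace M] [ChartedSpace Plane M]
    [IsManifold (𝓡 2) ∞ M] (E : PolarEnd M) {p : Plane} (hp : p ∈ outer E.R) :
    ∃ e ∈ IsManifold.maximalAtlas (𝓡 2) ∞ M, E.toFun p ∈ e.source ∧ e (E.toFun p) = p ∧
      e.symm =ᶠ[𝓝 p] E.toFun := by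
  obtain ⟨Φ, hpΦ, hEq⟩ := E.isLocalDiffeomorphOn ⟨p, hp⟩
  have hEqp : E.toFun p = Φ p := hEq hpΦ
  refine ⟨Φ.toOpenPartialHomeomorph.symm,
    OpenPartialHomeomorph.mem_maximalAtlas_of_contMDiffOn _ Φ.contMDiffOn_invFun
      Φ.contMDiffOn_toFun, ?_, ?_, ?_⟩
  · rw [hEqp]; exact Φ.map_source hpΦ
  · rw [hEqp]; exact Φ.left_inv hpΦ
  · filter_upwards [Φ.open_source.mem_nhds hpΦ] with z hz using (hEq hz).symm

lemma pullback_congr {M : Type*} [TopologicalSpace M] [ChartedSpace Plane M] (h : BilinField M)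
    {F F' : Plane → M} {y : Plane} (hF : F =ᶠ[𝓝 y] F') : pullback h F y = pullback h F' y := by
  ext i j
  have h1 := hF.self_of_nhds
  have h2 := hF.mfderiv_eq (I := 𝓡 2) (I' := 𝓡 2)
  -- The two sides involve tangent spaces at different points; typing both differentials as maps
  -- `Plane →L[ℝ] Plane` permits substitution.
  have key : ∀ (a b : M) (A : Plane →L[ℝ] Plane) (B : Plane →L[ℝ] Plane), a = b → A = B →
      h a (A (EuclideanSpace.single i (1 : ℝ))) (A (EuclideanSpace.single j (1 : ℝ))) =
      h b (B (EuclideanSpace.single i (1 : ℝ))) (B (EuclideanSpace.single j (1 : ℝ))) := by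
    rintro a b A B rfl rfl; rfl
  exact key _ _ _ _ h1 h2

/-! ### The Laplacian of a radial function on a conical end -/

section Cone

variable {α : ℝ} {p : Plane}

/-- The factors of the coframe `dr, α r dθ`. -/
noncomputable def coneCoscale (α : ℝ) (i : Fin 2) (p : Plane) : ℝ := if i = 0 then 1 else α * p 0

lemma coneScale_pos (hα : 0 < α) (hp : 0 < p 0) (i : Fin 2) : 0 < coneScale α i p := by
  unfold coneScale; split_ifs <;> positivity

lemma coneScale_mul_coneCoscale (hα : 0 < α) (hp : 0 < p 0) (i : Fin 2) :
    coneScale α i p * coneCoscale α i p = 1 := by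
  unfold coneScale coneCoscale; split_ifs
  · simp
  · field_simp

lemma differentiableAt_coneCoscale (i : Fin 2) : DifferentiableAt ℝ (coneCoscale α i) p := by
  unfold coneCoscale; split_ifs
  · exact differentiableAt_const _
  · exact (differentiableAt_coord 0).const_mul α

/-- The only nonzero derivative is `∂_r (α r) = α`, which in the frame becomes `1 / r`. -/
lemma abs_coneScale_mul_pd_coneCoscale_le (hα : 0 < α) (hp : 1 ≤ p 0) (i j : Fin 2) :
    |coneScale α i p * coneScale α j p * pd i (coneCoscale α j) p| ≤ 1 := by
  have h0 : ∀ i, pd i (coneCoscale α 0) p = 0 := fun i => by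
    have : coneCoscale α 0 = fun _ => 1 := by ext; simp [coneCoscale]
    rw [this, pd_const]
  have h1 : ∀ i, pd i (coneCoscale α 1) p = α * if (0 : Fin 2) = i then 1 else 0 := fun i => by
    have : coneCoscale α 1 = fun z => α * z 0 := by ext; simp [coneCoscale]
    rw [this, pd_const_mul _ (differentiableAt_coord 0),
      pd_coord]
  have hp0 : 0 < p 0 := by linarith
  fin_cases j
  · simp [h0]
  · fin_cases i
    · simp only [Fin.zero_eta, Fin.mk_one, h1, coneScale]
      simp only [if_true, one_ne_zero, if_false, one_mul, mul_one]
      rw [show (α * p 0)⁻¹ * α = (p 0)⁻¹ by field_simp, abs_of_pos (by positivity)]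
      exact inv_le_one_of_one_le₀ hp
    · simp [h1]

/-- A bound for the covariant derivative of the coframe `dr` of a metric on the cone
`dr² + α² r² dθ²` which is close to the conical metric. -/
lemma abs_trace_christoffel_le {G : Plane → Matrix (Fin 2) (Fin 2) ℝ}
    {k : Fin 2 → Fin 2 → Plane → ℝ} {C : ℝ} (hα : 0 < α) (hp : 1 ≤ p 0)
    (hk : ∀ i j, (fun z => G z i j) =ᶠ[𝓝 p]
      fun z => (k i j z + if i = j then 1 else 0) * (coneCoscale α i z * coneCoscale α j z))
    (hkd : ∀ i j, DifferentiableAt ℝ (k i j) p) (hk0 : ∀ i j, |k i j p| ≤ 1 / 4)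
    (hk1 : ∀ l i j, |coneDeriv α l (k i j) p| ≤ C) :
    |(G p)⁻¹ 0 0| ≤ 5 / 2 ∧
      |∑ i, ∑ j, (G p)⁻¹ i j * christoffel G 0 i j p| ≤ 75 * (C + 5 / 2) := by
  have hp0 : 0 < p 0 := by linarith
  set s := fun i => coneScale α i p with hs
  set t := fun i => coneCoscale α i p with ht
  have hst : ∀ i, s i * t i = 1 := coneScale_mul_coneCoscale hα hp0
  have hspos : ∀ i, 0 < s i := coneScale_pos hα hp0
  set κ : Fin 2 → Fin 2 → ℝ := fun i j => k i j p + if i = j then 1 else 0 with hκ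
  have hGp : ∀ i j, G p i j = κ i j * (t i * t j) := fun i j => (hk i j).self_of_nhds
  have hκle : ∀ i j, |κ i j| ≤ 5 / 4 := by
    intro i j
    refine (abs_add_le _ _).trans ?_
    have := hk0 i j
    split_ifs
    · rw [abs_one]; linarith
    · rw [abs_zero]; linarith
  have hC : 0 ≤ C := (abs_nonneg _).trans (hk1 0 0 0)
  -- From `|k| ≤ 1/4` the determinant is at least `(3/4)² - (1/4)² = 1/2`.
  have hdet : 1 / 2 ≤ κ 0 0 * κ 1 1 - κ 0 1 * κ 1 0 := by
    have a0 := abs_le.1 (hk0 0 0)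
    have a1 := abs_le.1 (hk0 1 1)
    have hb : |k 0 1 p * k 1 0 p| ≤ 1 / 4 * (1 / 4) := by
      rw [abs_mul]
      exact mul_le_mul (hk0 0 1) (hk0 1 0) (abs_nonneg _) (by norm_num)
    have hb' := (abs_le.1 hb).2
    simp only [hκ, if_true, one_ne_zero, zero_ne_one, if_false, add_zero]
    nlinarith
  set δ := κ 0 0 * κ 1 1 - κ 0 1 * κ 1 0 with hδ
  have hδpos : 0 < δ := by linarith
  set N : Matrix (Fin 2) (Fin 2) ℝ :=
    Matrix.of fun i j => s i * s j * (δ⁻¹ * (!![κ 1 1, -κ 0 1; -κ 1 0, κ 0 0] i j)) with hN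
  have hinv : (G p)⁻¹ = N := by
    apply Matrix.inv_eq_left_inv
    have e0 := hst 0
    have e1 := hst 1
    ext i j
    fin_cases i <;> fin_cases j <;>
      simp only [hN, Matrix.mul_apply, Fin.sum_univ_two, hGp, Matrix.of_apply, Matrix.cons_val',
        Matrix.cons_val_zero, Matrix.cons_val_one, Matrix.cons_val_fin_one, Fin.zero_eta,
        Fin.mk_one, Matrix.one_apply_eq, Fin.isValue]
    · calc _ = (s 0 * t 0) * δ⁻¹ * ((s 0 * t 0) * κ 0 0 * κ 1 1 - (s 1 * t 1) * κ 0 1 * κ 1 0) := by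
            ring
        _ = 1 := by rw [e0, e1]; field_simp; simp [hδ]
    · calc _ = s 0 * t 1 * δ⁻¹ * κ 1 1 * κ 0 1 * ((s 0 * t 0) - (s 1 * t 1)) := by ring
        _ = _ := by rw [e0, e1]; simp
    · calc _ = s 1 * t 0 * δ⁻¹ * κ 1 0 * κ 0 0 * ((s 1 * t 1) - (s 0 * t 0)) := by ring
        _ = _ := by rw [e0, e1]; simp
    · calc _ = (s 1 * t 1) * δ⁻¹ * ((s 1 * t 1) * κ 0 0 * κ 1 1 - (s 0 * t 0) * κ 0 1 * κ 1 0) := by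
            ring
        _ = 1 := by rw [e0, e1]; field_simp; simp [hδ]
  have hδinv : δ⁻¹ ≤ 2 := by
    rw [inv_le_comm₀ hδpos (by norm_num)]; linarith
  -- Cofactors at most `5/4`, divided by a determinant at least `1/2`.
  have hGinv : ∀ i j, |(G p)⁻¹ i j| ≤ 5 / 2 * (s i * s j) := by
    intro i j
    have hadj : |!![κ 1 1, -κ 0 1; -κ 1 0, κ 0 0] i j| ≤ 5 / 4 := by
      fin_cases i <;> fin_cases j <;> simp [hκle]
    rw [hinv, hN, Matrix.of_apply, abs_mul, abs_mul δ⁻¹,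
      abs_of_pos (mul_pos (hspos i) (hspos j)), abs_of_pos (inv_pos.2 hδpos)]
    have : δ⁻¹ * |!![κ 1 1, -κ 0 1; -κ 1 0, κ 0 0] i j| ≤ 2 * (5 / 4) :=
      mul_le_mul hδinv hadj (abs_nonneg _) (by norm_num)
    have h2 := mul_le_mul_of_nonneg_left this (mul_pos (hspos i) (hspos j)).le
    linarith
  have hs0 : s 0 = 1 := by simp [hs, coneScale]
  refine ⟨by simpa [hs0] using hGinv 0 0, ?_⟩
  -- Frame components of `∂G`: `C` comes from differentiating `k`, and `5/2 = 5/4 · 2` from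
  -- differentiating the two coframe factors.
  have hdG : ∀ i j l, s i * s j * s l * |pd i (fun z => G z j l) p| ≤ C + 5 / 2 := by
    intro i j l
    have hd : pd i (fun z => G z j l) p = pd i (k j l) p * (t j * t l) +
        κ j l * (pd i (coneCoscale α j) p * t l + t j * pd i (coneCoscale α l) p) := by
      have d1 := differentiableAt_coneCoscale (α := α) (p := p) j
      have d2 := differentiableAt_coneCoscale (α := α) (p := p) l
      rw [pd_congr (hk j l), pd_mul ((hkd j l).add_const _) (d1.fun_mul d2), pd_mul d1 d2,
        pd_add (hkd j l) (differentiableAt_const _), pd_const, add_zero]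
    have hpos : 0 < s i * s j * s l := mul_pos (mul_pos (hspos i) (hspos j)) (hspos l)
    rw [← abs_of_pos hpos, ← abs_mul, hd]
    have e : s i * s j * s l * (pd i (k j l) p * (t j * t l) +
        κ j l * (pd i (coneCoscale α j) p * t l + t j * pd i (coneCoscale α l) p)) =
        coneDeriv α i (k j l) p + κ j l * (s i * s j * pd i (coneCoscale α j) p +
          s i * s l * pd i (coneCoscale α l) p) := by
      have e1 := hst j
      have e2 := hst l
      calc _ = s i * pd i (k j l) p * ((s j * t j) * (s l * t l)) + κ j l *
            (s i * s j * pd i (coneCoscale α j) p * (s l * t l) +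
              s i * s l * pd i (coneCoscale α l) p * (s j * t j)) := by ring
        _ = _ := by rw [e1, e2]; simp [coneDeriv, hs]
    rw [e]
    refine (abs_add_le _ _).trans (add_le_add (hk1 i j l) ?_)
    rw [abs_mul]
    calc _ ≤ 5 / 4 * (1 + 1 : ℝ) := mul_le_mul (hκle j l)
          ((abs_add_le _ _).trans (add_le_add (abs_coneScale_mul_pd_coneCoscale_le hα hp i j)
            (abs_coneScale_mul_pd_coneCoscale_le hα hp i l))) (abs_nonneg _) (by norm_num)
      _ = 5 / 2 := by norm_num
  -- The constant is `1/2 · (5/2)² · 3 = 75/8`; the sum has eight such terms. The scale factors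
  -- cancel because the free upper index is radial, where `s 0 = 1`.
  have hterm : ∀ i j l, |(G p)⁻¹ i j * ((1 / 2) * (G p)⁻¹ 0 l *
      (pd i (fun z => G z j l) p + pd j (fun z => G z i l) p - pd l (fun z => G z i j) p))| ≤
      75 / 8 * (C + 5 / 2) := by
    intro i j l
    have b1 := hGinv i j
    have b2 := hGinv 0 l
    rw [hs0, one_mul] at b2
    have hX : s i * s j * s l * |pd i (fun z => G z j l) p + pd j (fun z => G z i l) p -
        pd l (fun z => G z i j) p| ≤ 3 * (C + 5 / 2) := by
      have c1 := hdG i j l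
      have c2 := hdG j i l
      have c3 := hdG l i j
      have hpos : 0 < s i * s j * s l := mul_pos (mul_pos (hspos i) (hspos j)) (hspos l)
      have := mul_le_mul_of_nonneg_left ((abs_sub _ _).trans (add_le_add_left
        (abs_add_le (pd i (fun z => G z j l) p) (pd j (fun z => G z i l) p))
          |pd l (fun z => G z i j) p|)) hpos.le
      linarith
    generalize pd i (fun z => G z j l) p + pd j (fun z => G z i l) p -
        pd l (fun z => G z i j) p = X at *
    rw [abs_mul, abs_mul, abs_mul, abs_of_pos (by norm_num : (0 : ℝ) < 1 / 2)]
    calc _ = 1 / 2 * (|(G p)⁻¹ i j| * |(G p)⁻¹ 0 l|) * |X| := by ring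
      _ ≤ 1 / 2 * (5 / 2 * (s i * s j) * (5 / 2 * s l)) * |X| := by
          have := mul_le_mul b1 b2 (abs_nonneg _)
            (mul_nonneg (by norm_num) (mul_pos (hspos i) (hspos j)).le)
          exact mul_le_mul_of_nonneg_right (mul_le_mul_of_nonneg_left this (by norm_num))
            (abs_nonneg _)
      _ = 25 / 8 * (s i * s j * s l * |X|) := by ring
      _ ≤ 25 / 8 * (3 * (C + 5 / 2)) := mul_le_mul_of_nonneg_left hX (by norm_num)
      _ = _ := by ring
  simp only [christoffel, Finset.mul_sum]
  calc _ ≤ ∑ i : Fin 2, ∑ j : Fin 2, ∑ l : Fin 2, (75 / 8 * (C + 5 / 2)) := by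
        refine (Finset.abs_sum_le_sum_abs _ _).trans (Finset.sum_le_sum fun i _ => ?_)
        refine (Finset.abs_sum_le_sum_abs _ _).trans (Finset.sum_le_sum fun j _ => ?_)
        exact (Finset.abs_sum_le_sum_abs _ _).trans (Finset.sum_le_sum fun l _ => hterm i j l)
    _ = _ := by simp; ring

lemma coordLaplacian_radial (G : Plane → Matrix (Fin 2) (Fin 2) ℝ) {f : ℝ → ℝ}
    (hf : ContDiff ℝ 2 f) (p : Plane) :
    coordLaplacian G (fun z => f (z 0)) p = (G p)⁻¹ 0 0 * deriv (deriv f) (p 0) -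
      deriv f (p 0) * ∑ i, ∑ j, (G p)⁻¹ i j * christoffel G 0 i j p := by
  have hproj : ∀ z : Plane, DifferentiableAt ℝ (fun z : Plane => z 0) z := fun z =>
    (differentiableAt_coord 0)
  have hf' : ContDiff ℝ 1 (deriv f) := by
    have : ContDiff ℝ (1 + 1) f := by norm_num; exact hf
    exact (contDiff_succ_iff_deriv.1 this).2.2
  have h1 : ∀ j, pd j (fun z => f (z 0)) =
      fun z => deriv f (z 0) * if (0 : Fin 2) = j then 1 else 0 := by
    intro j; ext z
    rw [pd_comp (f := fun z : Plane => z 0)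
      (hf.differentiable (by norm_num) _).hasDerivAt (hproj z), pd_coord]
  have h2 : ∀ i j, pd i (pd j (fun z => f (z 0))) p = (if (0 : Fin 2) = j then 1 else 0) *
      (deriv (deriv f) (p 0) * if (0 : Fin 2) = i then 1 else 0) := by
    intro i j
    rw [h1]
    simp_rw [mul_comm _ (if (0 : Fin 2) = j then (1 : ℝ) else 0)]
    have hd := (hf'.differentiable (by norm_num) (p 0)).hasDerivAt
    rw [pd_const_mul, pd_comp (f := fun z : Plane => z 0) hd (hproj p), pd_coord]
    exact DifferentiableAt.comp (f := fun z : Plane => z 0) p hd.differentiableAt (hproj p)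
  simp only [coordLaplacian, h2]
  simp only [h1, Fin.sum_univ_two, if_true, zero_ne_one, if_false]
  ring

end Cone

/-- A `C²` function which vanishes on `(-∞, ρ]`, grows linearly, and has bounded derivatives. -/
lemma exists_radial_function {ρ : ℝ} (hρ : 0 < ρ) : ∃ (f : ℝ → ℝ) (C : ℝ), ContDiff ℝ 2 f ∧
    (∀ s ≤ ρ, f s = 0) ∧ (∀ s, 0 ≤ f s) ∧ (∀ s, ρ + 1 ≤ s → f s = s) ∧
    (∀ s, |deriv f s| ≤ C) ∧ ∀ s, |deriv (deriv f) s| ≤ C := by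
  set f : ℝ → ℝ := fun s => s * Real.smoothTransition (s - ρ) with hf
  have hfs : ContDiff ℝ 2 f :=
    contDiff_id.mul (Real.smoothTransition.contDiff.comp (contDiff_id.sub contDiff_const))
  have h0 : ∀ s ≤ ρ, f s = 0 := fun s hs => by
    simp [hf, Real.smoothTransition.zero_of_nonpos (sub_nonpos.2 hs)]
  have h1 : ∀ s, ρ + 1 ≤ s → f s = s := fun s hs => by
    simp [hf, Real.smoothTransition.one_of_one_le (x := s - ρ) (by linarith)]
  have hf' : ContDiff ℝ 1 (deriv f) := by
    have : ContDiff ℝ (1 + 1) f := by norm_num; exact hfs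
    exact (contDiff_succ_iff_deriv.1 this).2.2
  obtain ⟨C1, hC1⟩ := (isCompact_Icc (a := ρ) (b := ρ + 1)).exists_bound_of_continuousOn
    hf'.continuous.continuousOn
  obtain ⟨C2, hC2⟩ := (isCompact_Icc (a := ρ) (b := ρ + 1)).exists_bound_of_continuousOn
    (hf'.continuous_deriv (by norm_num)).continuousOn
  have hlow : ∀ s < ρ, deriv f =ᶠ[𝓝 s] fun _ => 0 := fun s hs => by
    have : f =ᶠ[𝓝 s] fun _ => 0 := by
      filter_upwards [Iio_mem_nhds hs] with x hx using h0 x (le_of_lt hx)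
    simpa using this.deriv
  have hhigh : ∀ s, ρ + 1 < s → deriv f =ᶠ[𝓝 s] fun _ => 1 := fun s hs => by
    have : f =ᶠ[𝓝 s] fun x => x := by
      filter_upwards [Ioi_mem_nhds hs] with x hx using h1 x (le_of_lt hx)
    simpa using this.deriv
  -- Outside `[ρ, ρ + 1]` the first derivative is `0` or `1` and the second is `0`; on this interval
  -- compactness gives `C1` and `C2`.
  refine ⟨f, max 1 (max C1 C2), hfs, h0, fun s => ?_, h1, fun s => ?_, fun s => ?_⟩
  · rcases le_or_gt s ρ with h | h
    · rw [h0 s h]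
    · exact mul_nonneg (by linarith) (Real.smoothTransition.nonneg _)
  · rcases lt_or_ge s ρ with h | h
    · simp [(hlow s h).self_of_nhds]
    rcases lt_or_ge (ρ + 1) s with h' | h'
    · simp [(hhigh s h').self_of_nhds]
    · exact (hC1 s ⟨h, h'⟩).trans ((le_max_left _ _).trans (le_max_right _ _))
  · rcases lt_or_ge s ρ with h | h
    · simp [(hlow s h).deriv_eq]
    rcases lt_or_ge (ρ + 1) s with h' | h'
    · simp [(hhigh s h').deriv_eq]
    · exact (hC2 s ⟨h, h'⟩).trans ((le_max_right _ _).trans (le_max_right _ _))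

/-- Functions in `r^{-τ} Λ^{2,a}` are small, and have bounded derivatives, far out. -/
lemma MemWeightedHolder.exists_bound {α R τ a : ℝ} {k : Plane → ℝ} (hR : 0 < R) (hτ : 0 < τ)
    (h : MemWeightedHolder α R (-τ) a k) :
    ∃ C, ∀ᶠ ρ in atTop, ∀ p ∈ outer ρ, DifferentiableAt ℝ k p ∧ |k p| ≤ 1 / 4 ∧
      ∀ l, |coneDeriv α l k p| ≤ C := by
  obtain ⟨hsm, C, hC0, hC1, -, -⟩ := h
  have hlim : Tendsto (fun ρ : ℝ => ρ ^ (-τ) * |C|) atTop (𝓝 (0 * |C|)) :=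
    (tendsto_rpow_neg_atTop hτ).mul_const _
  rw [zero_mul] at hlim
  refine ⟨τ * |C| + |C|, ?_⟩
  filter_upwards [hlim.eventually (eventually_le_nhds (by norm_num : (0 : ℝ) < 1 / 4)),
    eventually_gt_atTop R, eventually_ge_atTop 1] with ρ h1 h2 h3 p hp
  have hpρ : ρ < p 0 := hp
  have hpR : p ∈ outer R := h2.trans hpρ
  have hp0 : 0 < p 0 := by linarith
  have hopen : IsOpen (outer R) := isOpen_lt continuous_const
    (EuclideanSpace.proj (0 : Fin 2) : Plane →L[ℝ] ℝ).continuous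
  set m : Plane → ℝ := fun z => z 0 ^ (- -τ) * k z with hm
  have hmd : DifferentiableAt ℝ m p :=
    (hsm.contDiffAt (hopen.mem_nhds hpR)).differentiableAt (by norm_num)
  -- Writing `k = r^{-τ} m` with `m` in the unweighted space, the product rule gives the derivative
  -- bound `τ |C| + |C|` for `r ≥ 1`.
  have hke : k =ᶠ[𝓝 p] fun z => z 0 ^ (-τ) * m z := by
    filter_upwards [hopen.mem_nhds hpR] with z hz
    have hz0 : 0 < z 0 := hR.trans hz
    simp only [hm, ← mul_assoc, ← Real.rpow_add hz0]
    simp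
  have hproj : DifferentiableAt ℝ (fun z : Plane => z 0) p :=
    (differentiableAt_coord 0)
  have hpow := Real.hasDerivAt_rpow_const (x := p 0) (p := -τ) (Or.inl hp0.ne')
  have hpowd : DifferentiableAt ℝ (fun z : Plane => z 0 ^ (-τ)) p :=
    DifferentiableAt.comp (f := fun z : Plane => z 0) p hpow.differentiableAt hproj
  have hmC : |m p| ≤ |C| := (hC0 p hpR).trans (le_abs_self C)
  have hpow1 : p 0 ^ (-τ) ≤ 1 := Real.rpow_le_one_of_one_le_of_nonpos (by linarith) (by linarith)
  have hpow0 : 0 ≤ p 0 ^ (-τ) := Real.rpow_nonneg hp0.le _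
  refine ⟨(hpowd.fun_mul hmd).congr_of_eventuallyEq hke, ?_, fun l => ?_⟩
  · rw [hke.self_of_nhds, abs_mul, abs_of_nonneg hpow0]
    refine le_trans (mul_le_mul ?_ hmC (abs_nonneg _) (Real.rpow_nonneg (by linarith) _)) h1
    exact Real.rpow_le_rpow_of_nonpos (by linarith) hpρ.le (by linarith)
  · have hd : coneDeriv α l k p = (coneScale α l p * if (0 : Fin 2) = l then 1 else 0) *
        (-τ * p 0 ^ (-τ - 1) * m p) + p 0 ^ (-τ) * coneDeriv α l m p := by
      rw [coneDeriv, pd_congr hke, pd_mul hpowd hmd,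
        pd_comp (f := fun z : Plane => z 0) hpow hproj, pd_coord, coneDeriv]
      ring
    have hs : |coneScale α l p * if (0 : Fin 2) = l then 1 else 0| ≤ 1 := by
      fin_cases l <;> simp [coneScale]
    rw [hd]
    refine (abs_add_le _ _).trans (add_le_add ?_ ?_)
    · rw [abs_mul, abs_mul _ (m p), abs_mul (-τ), abs_neg, abs_of_pos hτ,
        abs_of_nonneg (Real.rpow_nonneg hp0.le _)]
      have hpow2 : p 0 ^ (-τ - 1) ≤ 1 :=
        Real.rpow_le_one_of_one_le_of_nonpos (by linarith) (by linarith)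
      calc _ ≤ 1 * (τ * 1 * |C|) := by gcongr
        _ = _ := by ring
    · rw [abs_mul, abs_of_nonneg hpow0]
      calc _ ≤ 1 * |C| :=
            mul_le_mul hpow1 ((hC1 p hpR l).trans (le_abs_self C)) (abs_nonneg _) zero_le_one
        _ = _ := one_mul _

/-! ### An exhaustion function with bounded Laplacian -/

section Barrier

variable {M : Type*} [TopologicalSpace M] [ChartedSpace Plane M]

lemma isOpen_outer (ρ : ℝ) : IsOpen (outer ρ) :=
  isOpen_lt continuous_const (EuclideanSpace.proj (0 : Fin 2) : Plane →L[ℝ] ℝ).continuous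

lemma PolarEnd.exists_metric_bound (E : PolarEnd M) {h : BilinField M} {α τ a : ℝ} (hα : 0 < α)
    (hτ : 0 < τ) (hE : ∀ i k, MemWeightedHolder α E.R (-τ) a (coneError h E α i k)) :
    ∃ B, ∀ᶠ ρ in atTop, ∀ p ∈ outer ρ, |(pullback h E.toFun p)⁻¹ 0 0| ≤ 5 / 2 ∧
      |∑ i, ∑ j, (pullback h E.toFun p)⁻¹ i j * christoffel (pullback h E.toFun) 0 i j p| ≤ B := by
  choose C hC using fun i k => (hE i k).exists_bound E.R_pos hτ
  refine ⟨75 * ((∑ i, ∑ k, |C i k|) + 5 / 2), ?_⟩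
  have hall := eventually_all.2 fun i => eventually_all.2 fun k => hC i k
  filter_upwards [hall, eventually_ge_atTop 1, eventually_ge_atTop E.R] with ρ h1 h2 h3 p hp
  have hpρ : ρ < p 0 := hp
  refine abs_trace_christoffel_le (k := coneError h E α) hα (by linarith) (fun i j => ?_)
    (fun i j => (h1 i j p hp).1) (fun i j => (h1 i j p hp).2.1) (fun l i j => ?_)
  · filter_upwards [(isOpen_outer E.R).mem_nhds (h3.trans_lt hpρ)] with z hz
    have hz0 : 0 < z 0 := E.R_pos.trans hz
    have e1 := coneScale_mul_coneCoscale hα hz0 i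
    have e2 := coneScale_mul_coneCoscale hα hz0 j
    simp only [coneError, sub_add_cancel]
    calc _ = pullback h E.toFun z i j * ((coneScale α i z * coneCoscale α i z) *
          (coneScale α j z * coneCoscale α j z)) := by rw [e1, e2]; ring
      _ = _ := by ring
  · refine ((h1 i j p hp).2.2 l).trans ((le_abs_self _).trans ?_)
    exact (Finset.single_le_sum (f := fun j => |C i j|) (fun _ _ => abs_nonneg _)
      (Finset.mem_univ j)).trans (Finset.single_le_sum (f := fun i => ∑ j, |C i j|)
        (fun _ _ => Finset.sum_nonneg fun _ _ => abs_nonneg _) (Finset.mem_univ i))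

open Classical in
/-- The function `f(r)` on the ends, extended by zero. -/
noncomputable def radialExtension {n : ℕ} (E : Fin n → PolarEnd M) (f : ℝ → ℝ) (x : M) : ℝ :=
  if h : ∃ p : Plane, ∃ j, p ∈ outer (E j).R ∧ (E j).toFun p = x then f (h.choose 0) else 0

/-- The chosen preimage does not matter: disjointness of the ends fixes the end, and injectivity up
to `2π`-rotation fixes the radius. -/
lemma radialExtension_apply {n : ℕ} {E : Fin n → PolarEnd M}
    (hE : ∀ i j, i ≠ j →
      Disjoint ((E i).toFun '' outer (E i).R) ((E j).toFun '' outer (E j).R))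
    (f : ℝ → ℝ) {j : Fin n} {p : Plane} (hp : p ∈ outer (E j).R) :
    radialExtension E f ((E j).toFun p) = f (p 0) := by
  have h : ∃ q : Plane, ∃ i, q ∈ outer (E i).R ∧ (E i).toFun q = (E j).toFun p := ⟨p, j, hp, rfl⟩
  rw [radialExtension, dif_pos h]
  obtain ⟨i, hq, hqp⟩ := h.choose_spec
  have hij : i = j := by
    by_contra hne
    exact (hE i j hne).le_bot ⟨⟨_, hq, hqp⟩, ⟨p, hp, rfl⟩⟩
  subst hij
  rw [(((E i).eq_iff _ hq _ hp).1 hqp).1]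

lemma coordLaplacian_const (G : Plane → Matrix (Fin 2) (Fin 2) ℝ) (c : ℝ) (y : Plane) :
    coordLaplacian G (fun _ => c) y = 0 := by
  have : ∀ j, pd j (fun _ : Plane => c) = fun _ => 0 := fun j => funext fun z => pd_const c
  simp [coordLaplacian, this]

variable [IsManifold (𝓡 2) ∞ M]

/-- The Laplacian of `f(r)` is `gʳʳ f'' - f' gⁱʲ Γʳᵢⱼ`, and both metric factors are bounded far out
on each end. The chart may depend on the point, so polar coordinates can serve on the ends, with any
chart elsewhere. -/
theorem exists_barrier {τ a : ℝ} (hτ : 0 < τ) (g : Metric M)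
    (hg : IsAsymptoticallyConical g.inner τ a) :
    ∃ (φ : M → ℝ) (C : ℝ), 0 ≤ C ∧ Continuous φ ∧ (∀ x, 0 ≤ φ x) ∧
      (∀ L, ∃ K, IsCompact K ∧ ∀ x ∉ K, L < φ x) ∧
      ∀ x, ∃ e ∈ IsManifold.maximalAtlas (𝓡 2) ∞ M, x ∈ e.source ∧
        ContDiffAt ℝ 2 (φ ∘ e.symm) (e x) ∧ laplacianIn e g.inner φ x ≤ C := by
  obtain ⟨n, E, α, hdisj, hcomp, hα, hk⟩ := hg
  choose B hB using fun j => (E j).exists_metric_bound (hα j) hτ (hk j)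
  have hR : ∀ᶠ ρ in atTop, ∀ j, (E j).R < ρ := eventually_all.2 fun j => eventually_gt_atTop _
  obtain ⟨ρ₀, h1, h2, h3⟩ := ((eventually_all.2 hB).and (hR.and (eventually_gt_atTop 0))).exists
  -- The cutoff begins at `ρ₀ + 1`, so `f` vanishes in a neighbourhood of every radius `≤ ρ₀`, while
  -- the metric bounds hold for every radius `> ρ₀`.
  obtain ⟨f, C, hf, hf0, hfnn, hfid, hC1, hC2⟩ := exists_radial_function (ρ := ρ₀ + 1) (by linarith)
  have hC : 0 ≤ C := (abs_nonneg _).trans (hC1 0)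
  set φ := radialExtension E f with hφ
  have hφE : ∀ j, ∀ p ∈ outer (E j).R, φ ((E j).toFun p) = f (p 0) := fun j p hp =>
    radialExtension_apply hdisj f hp
  set C' := C * (5 / 2) + C * ∑ j, |B j| with hC'
  have hsum : 0 ≤ ∑ j, |B j| := Finset.sum_nonneg fun _ _ => abs_nonneg _
  have hC'0 : 0 ≤ C' := by positivity
  have hchart : ∀ x, ∃ e ∈ IsManifold.maximalAtlas (𝓡 2) ∞ M, x ∈ e.source ∧
      ContDiffAt ℝ 2 (φ ∘ e.symm) (e x) ∧ laplacianIn e g.inner φ x ≤ C' := by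
    intro x
    by_cases hx : ∃ j, x ∈ (E j).toFun '' outer (E j).R
    · obtain ⟨j, p, hp, rfl⟩ := hx
      obtain ⟨e, he, hxe, hep, hsymm⟩ := (E j).exists_chart hp
      have hev : φ ∘ e.symm =ᶠ[𝓝 p] fun z => f (z 0) := by
        filter_upwards [hsymm, (isOpen_outer _).mem_nhds hp] with z hz hz'
        simp only [Function.comp, hz, hφE j z hz']
      refine ⟨e, he, hxe, ?_, ?_⟩
      · rw [hep]
        refine ContDiffAt.congr_of_eventuallyEq ?_ hev
        exact (hf.comp (EuclideanSpace.proj (0 : Fin 2) : Plane →L[ℝ] ℝ).contDiff).contDiffAt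
      · have hpull : pullback g.inner e.symm =ᶠ[𝓝 p] pullback g.inner (E j).toFun :=
          hsymm.eventuallyEq_nhds.mono fun z hz => pullback_congr _ hz
        rw [laplacianIn, hep, coordLaplacian_congr hev, coordLaplacian_congr_metric hpull,
          coordLaplacian_radial _ hf]
        rcases le_or_gt (p 0) ρ₀ with h | h
        · have hz : f =ᶠ[𝓝 (p 0)] fun _ => 0 := by
            filter_upwards [Iio_mem_nhds (show p 0 < ρ₀ + 1 by linarith)] with s hs
              using hf0 s (le_of_lt hs)
          have hz1 : deriv f =ᶠ[𝓝 (p 0)] fun _ => 0 := by simpa using hz.deriv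
          rw [hz1.deriv_eq, hz1.self_of_nhds]
          simpa using hC'0
        · obtain ⟨b1, b2⟩ := h1 j p h
          have b3 : |B j| ≤ ∑ j, |B j| :=
            Finset.single_le_sum (f := fun j => |B j|) (fun _ _ => abs_nonneg _)
              (Finset.mem_univ j)
          refine (le_abs_self _).trans ((abs_sub _ _).trans (add_le_add ?_ ?_))
          · rw [abs_mul, mul_comm]
            exact mul_le_mul (hC2 _) b1 (abs_nonneg _) hC
          · rw [abs_mul]
            exact mul_le_mul (hC1 _) (b2.trans ((le_abs_self _).trans b3)) (abs_nonneg _) hC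
    -- Off the ends, `φ` must vanish on a whole neighbourhood; this uses that the sets `r ≥ ρ₀ + 1`
    -- are closed in `M`.
    · have hopen : IsOpen (⋃ j, (E j).toFun '' {p | ρ₀ + 1 ≤ p 0})ᶜ :=
        (isClosed_iUnion_of_finite fun j => (E j).isClosed _ (by linarith [h2 j])).isOpen_compl
      have hsub : ∀ j, {p : Plane | ρ₀ + 1 ≤ p 0} ⊆ outer (E j).R := fun j p hp => by
        have : ρ₀ + 1 ≤ p 0 := hp
        exact (show (E j).R < p 0 by linarith [h2 j])
      have hxU : x ∈ (⋃ j, (E j).toFun '' {p | ρ₀ + 1 ≤ p 0})ᶜ := by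
        intro hmem
        obtain ⟨j, hj⟩ := mem_iUnion.1 hmem
        exact hx ⟨j, image_mono (hsub j) hj⟩
      have hzero : ∀ z ∈ (⋃ j, (E j).toFun '' {p | ρ₀ + 1 ≤ p 0})ᶜ, φ z = 0 := by
        intro z hz
        by_cases hzE : ∃ j, z ∈ (E j).toFun '' outer (E j).R
        · obtain ⟨j, p, hp, rfl⟩ := hzE
          rw [hφE j p hp]
          apply hf0
          by_contra! hlt
          exact hz (mem_iUnion.2 ⟨j, p, hlt.le, rfl⟩)
        · rw [hφ, radialExtension, dif_neg]
          rintro ⟨p, j, hp, rfl⟩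
          exact hzE ⟨j, p, hp, rfl⟩
      set e := chartAt Plane x
      have hxe : x ∈ e.source := mem_chart_source Plane x
      have hev : φ ∘ e.symm =ᶠ[𝓝 (e x)] fun _ => 0 := by
        have hc := (e.continuousAt_symm (e.map_source hxe)).tendsto
        rw [e.left_inv hxe] at hc
        filter_upwards [hc.eventually (hopen.mem_nhds hxU)] with z hz using hzero _ hz
      refine ⟨e, IsManifold.chart_mem_maximalAtlas x, hxe, ?_, ?_⟩
      · exact contDiffAt_const.congr_of_eventuallyEq hev
      · rw [laplacianIn, coordLaplacian_congr hev, coordLaplacian_const]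
        exact hC'0
  refine ⟨φ, C', hC'0, ?_, ?_, ?_, hchart⟩
  · rw [continuous_iff_continuousAt]
    intro x
    obtain ⟨e, -, hxe, hsm, -⟩ := hchart x
    have hc : ContinuousAt ((φ ∘ e.symm) ∘ e) x :=
      ContinuousAt.comp hsm.continuousAt (e.continuousAt hxe)
    refine hc.congr ?_
    filter_upwards [e.open_source.mem_nhds hxe] with z hz
    simp [e.left_inv hz]
  · intro x
    rw [hφ, radialExtension]
    split_ifs
    · exact hfnn _
    · exact le_rfl
  · intro L
    set ρ₁ := max (ρ₀ + 1 + 1) L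
    refine ⟨_, hcomp ρ₁ fun j => ?_, fun x hx => ?_⟩
    · exact lt_of_lt_of_le (by linarith [h2 j]) (le_max_left _ _)
    · rw [notMem_compl_iff, mem_iUnion] at hx
      obtain ⟨j, p, hp, rfl⟩ := hx
      have hp1 : ρ₁ < p 0 := hp
      have hp2 := le_max_left (ρ₀ + 1 + 1) L
      have hp3 := le_max_right (ρ₀ + 1 + 1) L
      rw [hφE j p (show (E j).R < p 0 by linarith [h2 j]), hfid _ (by linarith)]
      linarith

end Barrier

/-! ### The comparison principle -/

lemma _root_.HasDerivAt.nonneg_of_forall_le_left {f : ℝ → ℝ} {f' t : ℝ} (hf : HasDerivAt f f' t)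
    (ht : 0 < t) (hmax : ∀ s ∈ Icc 0 t, f s ≤ f t) : 0 ≤ f' := by
  have h := (hasDerivWithinAt_iff_tendsto_slope' (s := Iio t) (by simp)).1 hf.hasDerivWithinAt
  refine ge_of_tendsto h ?_
  filter_upwards [Ioo_mem_nhdsLT ht] with s hs
  rw [slope_def_field]
  exact div_nonneg_of_nonpos (sub_nonpos.2 (hmax s ⟨hs.1.le, hs.2.le⟩)) (sub_nonpos.2 hs.2.le)

/-- The reaction term in the equation for `log v - log u`. -/
lemma log_rate_le {u v u' v' K : ℝ} (hu : 0 < u) (hv : 0 < v) (huv : u ≤ v)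
    (hK : |u'| ≤ K * u) :
    v' / v - u' / u ≤ (v' - u') / v + K * (Real.log v - Real.log u) := by
  have hr : 1 - u / v ≤ Real.log v - Real.log u := by
    have := Real.add_one_le_exp (Real.log u - Real.log v)
    rw [Real.exp_sub, Real.exp_log hu, Real.exp_log hv] at this
    linarith
  have h0 : 0 ≤ 1 - u / v := by
    rw [sub_nonneg, div_le_one hv]; exact huv
  have hK' : -(u' / u) ≤ K := by
    rw [← neg_div, div_le_iff₀ hu]
    exact (neg_le_abs u').trans hK
  have hK0 : 0 ≤ K := by
    by_contra! hneg
    linarith [abs_nonneg u', mul_neg_of_neg_of_pos hneg hu]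
  have e : v' / v - u' / u = (v' - u') / v + -(u' / u) * (1 - u / v) := by
    field_simp; ring
  rw [e]
  have : -(u' / u) * (1 - u / v) ≤ K * (1 - u / v) := mul_le_mul_of_nonneg_right hK' h0
  have : K * (1 - u / v) ≤ K * (Real.log v - Real.log u) := mul_le_mul_of_nonneg_left hr hK0
  linarith

section Comparison

variable {M : Type*} [TopologicalSpace M] [ChartedSpace Plane M] [IsManifold (𝓡 2) ∞ M]
  {g : Metric M} {u₀ v₀ : M → ℝ} {u v : ℝ → M → ℝ}

lemma IsSolution.contMDiff_log (hu : IsSolution g u₀ u) {t : ℝ} (ht : 0 < t) :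
    ContMDiff (𝓡 2) 𝓘(ℝ, ℝ) 2 (fun x => Real.log (u t x)) := fun x =>
  ContMDiffAt.comp (I' := 𝓘(ℝ, ℝ)) x
    (Real.contDiffAt_log.2 (hu.pos t ht.le x).ne').contMDiffAt (hu.contMDiff t ht x)

lemma IsSolution.continuousOn_log (hu : IsSolution g u₀ u) :
    ContinuousOn (fun p : ℝ × M => Real.log (u p.1 p.2)) (Ici 0 ×ˢ univ) :=
  hu.continuousOn.log fun p hp => (hu.pos p.1 hp.1 p.2).ne'

/-- Maximum principle for `F = e^{-Kt} (log v - log u) - ε φ - ε Λ t`. The barrier confines a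
positive maximum to a compact set, the exponential absorbs the reaction term of `log_rate_le`, and
`ε Λ t` makes the final inequality strict. -/
theorem IsSolution.le_of_initial_le {τ a : ℝ} (hτ : 0 < τ)
    (hg : IsAsymptoticallyConical g.inner τ a) (hu : IsSolution g u₀ u) (hv : IsSolution g v₀ v)
    (hle : ∀ x, v₀ x ≤ u₀ x) {T K m B : ℝ} (hm : 0 < m)
    (humB : ∀ t ∈ Icc 0 T, ∀ x, m ≤ u t x) (hvm : ∀ t ∈ Icc 0 T, ∀ x, m ≤ v t x)
    (hvB : ∀ t ∈ Icc 0 T, ∀ x, v t x ≤ B)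
    (hK : ∀ t ∈ Ioc 0 T, ∀ x, |deriv (fun s => u s x) t| ≤ K * u t x) :
    ∀ t ∈ Icc 0 T, ∀ x, v t x ≤ u t x := by
  by_contra! hcon
  obtain ⟨t₁, ht₁, x₁, hlt⟩ := hcon
  obtain ⟨φ, C, hC, hφc, hφ0, hφK, hφe⟩ := exists_barrier hτ g hg
  set W : ℝ → M → ℝ := fun t x => Real.log (v t x) - Real.log (u t x) with hW
  set b := Real.log B - Real.log m with hb
  have hWb : ∀ t ∈ Icc 0 T, ∀ x, W t x ≤ b := fun t ht x =>
    sub_le_sub (Real.log_le_log (hv.pos t ht.1 x) (hvB t ht x)) (Real.log_le_log hm (humB t ht x))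
  have hW1 : 0 < W t₁ x₁ := sub_pos.2 (Real.log_lt_log (hu.pos t₁ ht₁.1 x₁) hlt)
  have ht₁' : 0 < t₁ := by
    refine lt_of_le_of_ne ht₁.1 fun h => ?_
    rw [← h, hu.initial, hv.initial] at hlt
    exact absurd (hle x₁) (not_le.2 hlt)
  have hK0 : 0 ≤ K := by
    have := (abs_nonneg _).trans (hK t₁ ⟨ht₁', ht₁.2⟩ x₁)
    exact nonneg_of_mul_nonneg_left this (hu.pos t₁ ht₁.1 x₁)
  -- `C / m` pays for the Laplacian of the barrier divided by `v ≥ m`; the extra `1` produces the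
  -- contradiction.
  set Λ := C / m + 1 with hΛ
  have hΛ0 : 0 < Λ := by positivity
  set η := Real.exp (-(K * t₁)) * W t₁ x₁ with hη
  have hη0 : 0 < η := mul_pos (Real.exp_pos _) hW1
  obtain ⟨ε, hε, hεη⟩ : ∃ ε > 0, ε * (φ x₁ + Λ * t₁) < η := by
    have hpos : 0 < φ x₁ + Λ * t₁ + 1 := by have := hφ0 x₁; positivity
    refine ⟨η / (φ x₁ + Λ * t₁ + 1), by positivity, ?_⟩
    rw [div_mul_eq_mul_div, div_lt_iff₀ hpos]
    linarith
  set F : ℝ × M → ℝ := fun p =>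
    Real.exp (-(K * p.1)) * W p.1 p.2 - ε * φ p.2 - ε * Λ * p.1 with hF
  have hF1 : 0 < F (t₁, x₁) := by simp only [hF]; linarith
  have hexp : ∀ t ∈ Icc 0 T, ∀ x, Real.exp (-(K * t)) * W t x ≤ b := by
    intro t ht x
    have hb0 : 0 < b := hW1.trans_le (hWb t₁ ht₁ x₁)
    rcases le_or_gt (W t x) 0 with h | h
    · exact (mul_nonpos_of_nonneg_of_nonpos (Real.exp_pos _).le h).trans hb0.le
    · refine le_trans ?_ (hWb t ht x)
      exact mul_le_of_le_one_left h.le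
        (Real.exp_le_one_iff.2 (neg_nonpos.2 (mul_nonneg hK0 ht.1)))
  -- Beyond the level `b / ε` of `φ`, the barrier outweighs the upper bound `b`, so `F < 0` there.
  obtain ⟨S, hS, hSφ⟩ := hφK (b / ε)
  have hout : ∀ t ∈ Icc 0 T, ∀ x ∉ S, F (t, x) < 0 := by
    intro t ht x hx
    have h1 := hSφ x hx
    rw [div_lt_iff₀ hε] at h1
    have h2 := hexp t ht x
    have h3 : 0 ≤ ε * Λ * t := mul_nonneg (mul_nonneg hε.le hΛ0.le) ht.1
    simp only [hF]
    linarith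
  have hx₁S : x₁ ∈ S := by
    by_contra h
    exact absurd hF1 (not_lt.2 (hout t₁ ht₁ x₁ h).le)
  have hFc : ContinuousOn F (Icc 0 T ×ˢ S) := by
    have hsub : Icc 0 T ×ˢ S ⊆ Ici (0 : ℝ) ×ˢ (univ : Set M) := fun p hp => ⟨hp.1.1, mem_univ _⟩
    have h1 := (hv.continuousOn_log.sub hu.continuousOn_log).mono hsub
    have h2 : Continuous fun p : ℝ × M => Real.exp (-(K * p.1)) := by fun_prop
    have h3 : Continuous fun p : ℝ × M => ε * φ p.2 := by fun_prop
    have h4 : Continuous fun p : ℝ × M => ε * Λ * p.1 := by fun_prop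
    exact ((h2.continuousOn.mul h1).sub h3.continuousOn).sub h4.continuousOn
  obtain ⟨⟨t₀, x₀⟩, ⟨ht₀, hx₀⟩, hmax⟩ :=
    (isCompact_Icc.prod hS).exists_isMaxOn ⟨(t₁, x₁), ht₁, hx₁S⟩ hFc
  have hF0 : 0 < F (t₀, x₀) := hF1.trans_le (hmax ⟨ht₁, hx₁S⟩)
  have hglob : ∀ t ∈ Icc 0 T, ∀ x, F (t, x) ≤ F (t₀, x₀) := by
    intro t ht x
    by_cases hx : x ∈ S
    · exact hmax ⟨ht, hx⟩
    · exact (hout t ht x hx).le.trans hF0.le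
  simp only at ht₀ hx₀
  have hW0 : 0 < W t₀ x₀ := by
    have h3 : 0 ≤ ε * Λ * t₀ := mul_nonneg (mul_nonneg hε.le hΛ0.le) ht₀.1
    have h4 := mul_nonneg hε.le (hφ0 x₀)
    have h5 : 0 < Real.exp (-(K * t₀)) * W t₀ x₀ := by
      simp only [hF] at hF0; linarith
    exact pos_of_mul_pos_right h5 (Real.exp_pos _).le
  have hv0 := hv.pos t₀ ht₀.1 x₀
  have hu0 := hu.pos t₀ ht₀.1 x₀
  have huv : u t₀ x₀ ≤ v t₀ x₀ :=
    ((Real.log_lt_log_iff hu0 hv0).1 (sub_pos.1 hW0)).le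
  have ht₀' : 0 < t₀ := by
    refine lt_of_le_of_ne ht₀.1 fun h => ?_
    rw [← h] at hW0
    simp only [hW, hu.initial, hv.initial] at hW0
    have hv00 := hv.pos 0 le_rfl x₀
    rw [hv.initial] at hv00
    linarith [Real.log_le_log hv00 (hle x₀)]
  obtain ⟨e, he, hxe, hφs, hφL⟩ := hφe x₀
  have hy : e x₀ ∈ e.target := e.map_source hxe
  set A := Real.exp (-(K * t₀)) with hA
  have hA0 : 0 < A := Real.exp_pos _
  set lv := laplacianIn e g.inner (fun y => Real.log (v t₀ y)) x₀ with hlv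
  set lu := laplacianIn e g.inner (fun y => Real.log (u t₀ y)) x₀ with hlu
  -- The second derivative test in `x` at the maximum of `F(t₀, ·)`.
  have hspace : A * (lv - lu) ≤ ε * C := by
    have sv := contDiffAt_comp_chart_symm he hy (hv.contMDiff_log ht₀')
    have su := contDiffAt_comp_chart_symm he hy (hu.contMDiff_log ht₀')
    have sv' := (contDiffAt_const (c := A)).mul sv
    have su' := (contDiffAt_const (c := -A)).mul su
    have sφ' := (contDiffAt_const (c := -ε)).mul hφs
    have hloc : IsLocalMax (fun z => A * Real.log (v t₀ (e.symm z)) +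
        (-A * Real.log (u t₀ (e.symm z)) + -ε * φ (e.symm z))) (e x₀) := by
      refine Eventually.of_forall fun z => ?_
      have := hglob t₀ ht₀ (e.symm z)
      simp only [hF, hW, e.left_inv hxe] at this ⊢
      linarith
    have hlap := coordLaplacian_nonpos_of_isLocalMax (posDef_pullback he hy g)
      (sv'.add (su'.add sφ')) hloc
    rw [coordLaplacian_add sv' (su'.add sφ'), coordLaplacian_add su' sφ'] at hlap
    have e1 := coordLaplacian_const_mul (G := pullback g.inner e.symm) A sv
    have e2 := coordLaplacian_const_mul (G := pullback g.inner e.symm) (-A) su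
    have e3 := coordLaplacian_const_mul (G := pullback g.inner e.symm) (-ε) hφs
    have hφL' : ε * coordLaplacian (pullback g.inner e.symm) (φ ∘ e.symm) (e x₀) ≤ ε * C :=
      mul_le_mul_of_nonneg_left hφL hε.le
    change _ = A * lv at e1
    change _ = -A * lu at e2
    have hsum : A * lv + (-A * lu +
        -ε * coordLaplacian (pullback g.inner e.symm) (φ ∘ e.symm) (e x₀)) ≤ 0 := by
      rw [← e1, ← e2, ← e3]; exact hlap
    linarith
  have dv := hv.equation t₀ ht₀' e he x₀ hxe
  have du := hu.equation t₀ ht₀' e he x₀ hxe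
  rw [← hlv] at dv
  rw [← hlu] at du
  set R := scalarCurvIn e g.inner x₀
  have dE : HasDerivAt (fun t => Real.exp (-(K * t))) (A * -(K * 1)) t₀ :=
    (((hasDerivAt_id t₀).const_mul K).neg).exp
  have dF := ((dE.mul ((dv.log hv0.ne').sub (du.log hu0.ne'))).sub_const (ε * φ x₀)).sub
    ((hasDerivAt_id t₀).const_mul (ε * Λ))
  -- Only earlier times are compared, since `t₀ = T` is possible.
  have htime := dF.nonneg_of_forall_le_left ht₀' fun s hs => by
    exact hglob s ⟨hs.1, hs.2.trans ht₀.2⟩ x₀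
  have hKu := hK t₀ ⟨ht₀', ht₀.2⟩ x₀
  rw [du.deriv] at hKu
  have hrate := log_rate_le (v' := lv - R) hu0 hv0 huv hKu
  have hrate' := mul_le_mul_of_nonneg_left hrate hA0.le
  have hlast : A * ((lv - R - (lu - R)) / v t₀ x₀) ≤ ε * (C / m) := by
    calc _ = A * (lv - lu) / v t₀ x₀ := by ring
      _ ≤ ε * C / v t₀ x₀ := by gcongr
      _ ≤ ε * C / m := by
          have := hvm t₀ ht₀ x₀
          gcongr
      _ = _ := by ring
  simp only [Pi.sub_apply, mul_one] at htime
  -- The curvature `R` of the background cancels in `v' - u'` and the `K` terms cancel each other,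
  -- leaving `0 ≤ ε C / m - ε Λ = -ε`.
  have hfin : ε * Λ = ε * (C / m) + ε := by rw [hΛ]; ring
  have hexpand : A * ((lv - R - (lu - R)) / v t₀ x₀ +
      K * (Real.log (v t₀ x₀) - Real.log (u t₀ x₀))) =
      A * ((lv - R - (lu - R)) / v t₀ x₀) +
      A * K * (Real.log (v t₀ x₀) - Real.log (u t₀ x₀)) := by ring
  linarith

end Comparison

/-! ### ### Scaling, a priori bounds and monotonicity of `u / t` -/

section Scaling

variable {M : Type*} [TopologicalSpace M] [ChartedSpace Plane M] [IsManifold (𝓡 2) ∞ M]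
  {g : Metric M} {u₀ : M → ℝ} {u : ℝ → M → ℝ}

lemma coordLaplacian_const_add (G : Plane → Matrix (Fin 2) (Fin 2) ℝ) (c : ℝ) (f : Plane → ℝ)
    (y : Plane) : coordLaplacian G (fun z => c + f z) y = coordLaplacian G f y := by
  have : ∀ j, pd j (fun z => c + f z) = pd j f := fun j => by
    ext z; simp [pd, fderiv_const_add]
  simp only [coordLaplacian, this]

/-- Parabolic rescaling of a solution. -/
lemma IsSolution.rescale (hu : IsSolution g u₀ u) {l : ℝ} (hl : 0 < l) :
    IsSolution g (fun x => l⁻¹ * u₀ x) (fun t x => l⁻¹ * u (l * t) x) where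
  pos t ht x := mul_pos (inv_pos.2 hl) (hu.pos _ (mul_nonneg hl.le ht) x)
  initial x := by rw [mul_zero, hu.initial]
  continuousOn := by
    refine continuousOn_const.mul (hu.continuousOn.comp
      (f := fun p : ℝ × M => (l * p.1, p.2)) (by fun_prop) fun p hp => ⟨?_, mem_univ _⟩)
    exact mul_nonneg hl.le hp.1
  contMDiff t ht := contMDiff_const.mul (hu.contMDiff _ (mul_pos hl ht))
  equation t ht e he x hx := by
    have hd := hu.equation (l * t) (mul_pos hl ht) e he x hx
    have hd2 := ((hd.comp t ((hasDerivAt_id t).const_mul l)).const_mul l⁻¹)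
    have hlap : laplacianIn e g.inner (fun y => Real.log (l⁻¹ * u (l * t) y)) x =
        laplacianIn e g.inner (fun y => Real.log (u (l * t) y)) x := by
      have : (fun y => Real.log (l⁻¹ * u (l * t) y)) =
          fun y => Real.log l⁻¹ + Real.log (u (l * t) y) := by
        ext y
        rw [Real.log_mul (inv_ne_zero hl.ne') (hu.pos _ (mul_nonneg hl.le ht.le) y).ne']
      rw [this]
      exact coordLaplacian_const_add _ _ _ _
    rw [hlap]
    convert! hd2 using 1
    field_simp

/-- A bound on the curvature of `u(t) g` controls the logarithmic derivative of `u`. -/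
lemma IsSolution.abs_deriv_le (hu : IsSolution g u₀ u) {T K : ℝ}
    (hK : ∀ t, 0 < t → t ≤ T → ∀ e ∈ IsManifold.maximalAtlas (𝓡 2) ∞ M, ∀ x ∈ e.source,
      |scalarCurvIn e (conformal (u t) g.inner) x| ≤ K) {t : ℝ} (ht : t ∈ Ioc 0 T) (x : M) :
    DifferentiableAt ℝ (fun s => u s x) t ∧ |deriv (fun s => u s x) t| ≤ K * u t x := by
  have he := IsManifold.chart_mem_maximalAtlas (I := 𝓡 2) (n := ∞) x
  have hx := mem_chart_source Plane x
  have hd := hu.equation t ht.1 _ he x hx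
  have hpos := hu.pos t ht.1.le x
  have hR := hK t ht.1 ht.2 _ he x hx
  rw [scalarCurvIn_conformal he hx g (hu.contMDiff t ht.1) (hu.pos t ht.1.le), abs_div,
    abs_of_pos hpos, div_le_iff₀ hpos, abs_sub_comm] at hR
  exact ⟨hd.differentiableAt, by rw [hd.deriv]; exact hR⟩

/-- Mean value inequality for `log u` in time; continuity of `u` up to `t = 0` brings in the initial
value. -/
lemma IsSolution.abs_log_sub_le (hu : IsSolution g u₀ u) {T K : ℝ}
    (hK : ∀ t, 0 < t → t ≤ T → ∀ e ∈ IsManifold.maximalAtlas (𝓡 2) ∞ M, ∀ x ∈ e.source,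
      |scalarCurvIn e (conformal (u t) g.inner) x| ≤ K) {t : ℝ} (ht : t ∈ Icc 0 T) (x : M) :
    |Real.log (u t x) - Real.log (u₀ x)| ≤ K * t := by
  have hcont : ContinuousOn (fun s => Real.log (u s x)) (Icc 0 T) :=
    hu.continuousOn_log.comp (f := fun s : ℝ => (s, x)) (by fun_prop)
      fun s hs => ⟨hs.1, mem_univ _⟩
  have hder : ∀ s ∈ Ioo 0 T, HasDerivAt (fun s => Real.log (u s x))
      (deriv (fun s => u s x) s / u s x) s := fun s hs =>
    ((hu.abs_deriv_le hK ⟨hs.1, hs.2.le⟩ x).1.hasDerivAt).log (hu.pos s hs.1.le x).ne'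
  have habs : ∀ s ∈ Ioo 0 T, |deriv (fun s => u s x) s / u s x| ≤ K := fun s hs => by
    have hpos := hu.pos s hs.1.le x
    rw [abs_div, abs_of_pos hpos, div_le_iff₀ hpos]
    exact (hu.abs_deriv_le hK ⟨hs.1, hs.2.le⟩ x).2
  have hdiff : DifferentiableOn ℝ (fun s => Real.log (u s x)) (interior (Icc 0 T)) := by
    rw [interior_Icc]
    exact fun s hs => (hder s hs).differentiableAt.differentiableWithinAt
  have h0 : (0 : ℝ) ∈ Icc 0 T := ⟨le_rfl, ht.1.trans ht.2⟩
  have hup := (convex_Icc (0 : ℝ) T).image_sub_le_mul_sub_of_deriv_le hcont hdiff (C := K)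
    (by rw [interior_Icc]; intro s hs
        rw [(hder s hs).deriv]; exact (abs_le.1 (habs s hs)).2) 0 h0 t ht ht.1
  have hlow := (convex_Icc (0 : ℝ) T).mul_sub_le_image_sub_of_le_deriv hcont hdiff (C := -K)
    (by rw [interior_Icc]; intro s hs
        rw [(hder s hs).deriv]; exact (abs_le.1 (habs s hs)).1) 0 h0 t ht ht.1
  rw [hu.initial, sub_zero] at hup hlow
  exact abs_le.2 ⟨by linarith, hup⟩

lemma IsSolution.exists_bounds (hu : IsSolution g u₀ u)
    (hu₀ : ∃ c C : ℝ, 0 < c ∧ ∀ x, c ≤ u₀ x ∧ u₀ x ≤ C) (hR : HasBoundedCurvature g u)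
    {T : ℝ} (hT : 0 < T) :
    ∃ m B : ℝ, 0 < m ∧ ∀ t ∈ Icc 0 T, ∀ x, m ≤ u t x ∧ u t x ≤ B := by
  obtain ⟨c, C, hc, hcC⟩ := hu₀
  obtain ⟨K, hK⟩ := hR T hT
  refine ⟨c * Real.exp (-(|K| * T)), C * Real.exp (|K| * T), by positivity, fun t ht x => ?_⟩
  have hlog := hu.abs_log_sub_le hK ht x
  have hKt : K * t ≤ |K| * T :=
    (mul_le_mul_of_nonneg_right (le_abs_self K) ht.1).trans
      (mul_le_mul_of_nonneg_left ht.2 (abs_nonneg K))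
  obtain ⟨h1, h2⟩ := abs_le.1 (hlog.trans hKt)
  have hu0pos : 0 < u₀ x := hc.trans_le (hcC x).1
  have hupos := hu.pos t ht.1 x
  have e1 : u t x = u₀ x * Real.exp (Real.log (u t x) - Real.log (u₀ x)) := by
    rw [Real.exp_sub, Real.exp_log hupos, Real.exp_log hu0pos]; field_simp
  rw [e1]
  constructor
  · exact mul_le_mul (hcC x).1 (Real.exp_le_exp.2 h1) (Real.exp_pos _).le hu0pos.le
  · exact mul_le_mul (hcC x).2 (Real.exp_le_exp.2 h2) (Real.exp_pos _).le
      (hu0pos.le.trans (hcC x).2)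

/-- Comparison of `u` with its rescaling on `[0, t]`. The rescaled solution looks ahead to time `l
t`, so the two-sided bounds are taken on `[0, l t]`, while the curvature bound is needed only up to
`t`. -/
theorem IsSolution.le_mul_of_one_le {τ a : ℝ} (hτ : 0 < τ)
    (hg : IsAsymptoticallyConical g.inner τ a) (hu : IsSolution g u₀ u)
    (hu₀ : ∃ c C : ℝ, 0 < c ∧ ∀ x, c ≤ u₀ x ∧ u₀ x ≤ C) (hR : HasBoundedCurvature g u)
    {l t : ℝ} (hl : 1 ≤ l) (ht : 0 < t) (x : M) : u (l * t) x ≤ l * u t x := by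
  have hl0 : 0 < l := by linarith
  have hlt : t ≤ l * t := le_mul_of_one_le_left ht.le hl
  obtain ⟨m, B, hm, hb⟩ := hu.exists_bounds hu₀ hR (mul_pos hl0 ht)
  obtain ⟨K, hK⟩ := hR t ht
  have hmem : ∀ s ∈ Icc 0 t, l * s ∈ Icc 0 (l * t) := fun s hs =>
    ⟨mul_nonneg hl0.le hs.1, mul_le_mul_of_nonneg_left hs.2 hl0.le⟩
  have hlinv : l⁻¹ ≤ 1 := inv_le_one_of_one_le₀ hl
  -- As `l⁻¹ ≤ 1`, the lower bound `l⁻¹ m` of the rescaled solution is also one for `u`.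
  have key := hu.le_of_initial_le hτ hg (hu.rescale hl0) (T := t) (m := l⁻¹ * m) (B := l⁻¹ * B)
    (K := K) (fun x => ?_) (by positivity) (fun s hs x => ?_) (fun s hs x => ?_)
    (fun s hs x => ?_) (fun s hs x => (hu.abs_deriv_le hK hs x).2) t ⟨ht.le, le_rfl⟩ x
  · rwa [inv_mul_le_iff₀ hl0] at key
  · obtain ⟨c, C, hc, hcC⟩ := hu₀
    exact mul_le_of_le_one_left (hc.le.trans (hcC x).1) hlinv
  · exact (mul_le_of_le_one_left hm.le hlinv).trans (hb s ⟨hs.1, hs.2.trans hlt⟩ x).1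
  · exact mul_le_mul_of_nonneg_left (hb _ (hmem s hs) x).1 (inv_pos.2 hl0).le
  · exact mul_le_mul_of_nonneg_left (hb _ (hmem s hs) x).2 (inv_pos.2 hl0).le

end Scaling

end ConicalRicci

/-! ### ### The derivative estimate and linear growth -/

theorem mainTheorem6 {M : Type*} [TopologicalSpace M] [T2Space M] [SecondCountableTopology M]
    [ConnectedSpace M] [NoncompactSpace M] [ChartedSpace ConicalRicci.Plane M]
    [IsManifold (𝓡 2) ∞ M]
    (τ a : ℝ) (hτ : 0 < τ) (ha : 0 < a) (ha' : a < 1)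
    (g₀ : ConicalRicci.Metric M) (hg₀ : ConicalRicci.IsAsymptoticallyConical g₀.inner τ a)
    (u₀ : M → ℝ) (hu₀ : ∃ c C : ℝ, 0 < c ∧ ∀ x, c ≤ u₀ x ∧ u₀ x ≤ C)
    (u : ℝ → M → ℝ) (hu : ConicalRicci.IsSolution g₀ u₀ u)
    (hR : ConicalRicci.HasBoundedCurvature g₀ u) :
    (∀ t, 0 < t → ∀ x, deriv (fun s => u s x) t ≤ u t x / t) ∧
      ∃ C : ℝ, 0 < C ∧ ∀ t, 0 ≤ t → ∀ x, u t x ≤ C * (1 + t) := by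
  have hmono : ∀ {l t : ℝ}, 1 ≤ l → 0 < t → ∀ x, u (l * t) x ≤ l * u t x := fun hl ht x =>
    hu.le_mul_of_one_le hτ hg₀ hu₀ hR hl ht x
  refine ⟨fun t ht x => ?_, ?_⟩
  · have hd : HasDerivAt (fun s => u s x) (deriv (fun s => u s x) t) t :=
      (hu.equation t ht _ (IsManifold.chart_mem_maximalAtlas x) x
        (mem_chart_source _ x)).differentiableAt.hasDerivAt
    have hq := (hasDerivWithinAt_iff_tendsto_slope' (s := Ioi t) (by simp)).1 hd.hasDerivWithinAt
    -- With `l = s / t`, monotonicity bounds each right difference quotient: `(u(s) - u(t)) / (s -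
    -- t) ≤ u(t) / t`.
    refine le_of_tendsto hq ?_
    filter_upwards [self_mem_nhdsWithin] with s hs
    have hst : t < s := hs
    have h1 := hmono ((one_le_div ht).2 hst.le) ht x
    rw [div_mul_cancel₀ _ ht.ne'] at h1
    rw [slope_def_field, div_le_div_iff₀ (sub_pos.2 hst) ht]
    have h2 := mul_le_mul_of_nonneg_right h1 ht.le
    have h3 : s / t * u t x * t = s * u t x := by field_simp
    linarith
  · obtain ⟨m, B, hm, hb⟩ := hu.exists_bounds hu₀ hR one_pos
    have hB : ∀ t ∈ Icc (0 : ℝ) 1, ∀ x, u t x ≤ |B| := fun t ht x =>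
      (hb t ht x).2.trans (le_abs_self B)
    -- For `t ≤ 1` the bound `|B|` on `[0, 1]` suffices; for `t > 1`, `u(t) ≤ t u(1) ≤ t |B|`.
    -- Adding `1` keeps the constant positive.
    refine ⟨|B| + 1, by positivity, fun t ht x => ?_⟩
    have hB0 := abs_nonneg B
    rcases le_or_gt t 1 with h | h
    · have := hB t ⟨ht, h⟩ x
      nlinarith
    · have h1 := hmono h.le one_pos x
      rw [mul_one] at h1
      have h2 := hB 1 ⟨zero_le_one, le_rfl⟩ x
      nlinarith
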